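/- Theorem 4.1. For $i=1,2$, let $A_i$ and $B_i$ be infinite hyperbolic groups. Suppose that there are homeomorphisms of Gromov boundaries $\partial A_1\cong\partial A_2$ and $\partial B_1\cong\partial B_2$. Then the free products $A_1*B_1$ and $A_2*B_2$ are hyperbolic groups, and their Gromov boundaries $\partial(A_1*B_1)$ and $\partial(A_2*B_2)$ are homeomorphic. Here a group is hyperbolic if its Cayley graph with respect to some finite generating set is Gromov hyperbolic. For a finite generating set $S$ of a hyperbolic group $G$, the Gromov boundary $\partial G$ is the set of geodesic rays in the Cayley graph of $(G,S)$ starting at $1$, two rays being identified when they stay at bounded distance from each other, with the quotient of the topology of uniform convergence on compact sets. The finite generating sets of $A_i$ and $B_i$ used for the hypothesis and those of $A_i*B_i$ used for the conclusion are arbitrary. -/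

import Mathlib

open scoped Monoid.Coprod

namespace HypGroup

/-- `S` is a finite generating set of the group `G`. -/
def IsFiniteGeneratingSet {G : Type*} [Group G] (S : Set G) : Prop :=
  S.Finite ∧ Subgroup.closure S = ⊤

/-- The word metric on `G` given by `S`: the path metric on the vertices of the Cayley graph of
`G` with respect to `S`. It is only used for generating sets `S`, for which that graph is
connected. -/
noncomputable def wordDist {G : Type*} [Group G] (S : Set G) (x y : G) : ℕ :=
  (SimpleGraph.mulCayley S).dist x y

/-- Gromov's four-point condition for the word metric: for some `δ`, the largest two of the three
sums of opposite distances among any four points differ by at most `δ`. -/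
def IsHyperbolicWith {G : Type*} [Group G] (S : Set G) : Prop :=
  ∃ δ : ℕ, ∀ x y z w : G,
    wordDist S x y + wordDist S z w ≤
      max (wordDist S x z + wordDist S y w) (wordDist S x w + wordDist S y z) + δ

/-- A (word) hyperbolic group: a group with a finite generating set whose Cayley graph is
Gromov hyperbolic. -/
def IsHyperbolicGroup (G : Type*) [Group G] : Prop :=
  ∃ S : Set G, IsFiniteGeneratingSet S ∧ IsHyperbolicWith S

/-- Geodesic rays in the Cayley graph of `G` with respect to `S` that start at the identity, as
sequences of vertices. -/
def GeodesicRay {G : Type*} [Group G] (S : Set G) : Type _ :=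
  {ρ : ℕ → G // ρ 0 = 1 ∧ ∀ m k : ℕ, wordDist S (ρ m) (ρ (m + k)) = k}

/-- The topology of uniform convergence on compact sets (the compact-open topology): on sequences of
vertices it is pointwise convergence, with `G` discrete. -/
instance {G : Type*} [Group G] (S : Set G) : TopologicalSpace (GeodesicRay S) :=
  TopologicalSpace.induced Subtype.val (@Pi.topologicalSpace ℕ (fun _ => G) (fun _ => ⊥))

theorem GeodesicRay.reachable {G : Type*} [Group G] {S : Set G} (ρ : GeodesicRay S) (n : ℕ) :
    (SimpleGraph.mulCayley S).Reachable 1 (ρ.1 n) := by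
  rcases Nat.eq_zero_or_pos n with rfl | hn
  · rw [ρ.2.1]
  · apply SimpleGraph.Reachable.of_dist_ne_zero
    have h := ρ.2.2 0 n
    rw [ρ.2.1, Nat.zero_add] at h
    unfold wordDist at h
    omega

/-- Two geodesic rays are equivalent if they stay at bounded distance from each other. -/
def raySetoid {G : Type*} [Group G] (S : Set G) : Setoid (GeodesicRay S) where
  r ρ σ := ∃ C : ℕ, ∀ n : ℕ, wordDist S (ρ.1 n) (σ.1 n) ≤ C
  iseqv :=
    { refl := fun ρ => ⟨0, fun n => by simp [wordDist]⟩
      symm := fun {ρ σ} ⟨C, h⟩ => ⟨C, fun n => by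
        have := h n
        unfold wordDist at this ⊢
        rwa [SimpleGraph.dist_comm]⟩
      trans := fun {ρ σ τ} ⟨C, h⟩ ⟨D, k⟩ => ⟨C + D, fun n => by
        obtain ⟨p, hp⟩ := ((ρ.reachable n).symm.trans (σ.reachable n)).exists_walk_length_eq_dist
        obtain ⟨q, hq⟩ := ((σ.reachable n).symm.trans (τ.reachable n)).exists_walk_length_eq_dist
        have h1 := h n
        have h2 := k n
        have h3 := SimpleGraph.dist_le (p.append q)
        rw [SimpleGraph.Walk.length_append, hp, hq] at h3
        unfold wordDist at h1 h2 ⊢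
        omega⟩ }

/-- The Gromov boundary of `G`, computed in the Cayley graph with respect to `S`: equivalence
classes of geodesic rays. -/
def GromovBoundary {G : Type*} [Group G] (S : Set G) : Type _ :=
  Quotient (raySetoid S)

/-- The topology of the Gromov boundary: the quotient of the compact-open topology on rays from the
base point. -/
instance {G : Type*} [Group G] (S : Set G) : TopologicalSpace (GromovBoundary S) :=
  inferInstanceAs (TopologicalSpace (Quotient (raySetoid S)))

end HypGroup

/-! For a hyperbolic group `G`, the union of `G` and its boundary is a compactification of the
discrete countable set `G`; its points are the ends of generalized rays, which may be finite. A
homeomorphism of boundaries extends to a homeomorphism of the compactifications: it suffices to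
biject the elements so that far-out elements pointing in nearby directions are sent to far-out
elements pointing in nearby directions. Such a bijection comes from shadows, a Hall-type choice in
both directions and Schröder–Bernstein (`exists_equiv_isClosed_rayCorrespondence`). It is not a
homomorphism, but it fixes `1`, so it can be applied to each syllable of a reduced word
(`letterwise`).

The Cayley graph of a free product is a tree of copies of the Cayley graphs of the factors, one for
each coset `w G i`. The nearest-point projection of `x` to this coset is read off as `head i (w⁻¹ *
x)`. If two points project differently, every geodesic between them passes through both projections
(`wordDist_of_head_ne`); this gives the four-point condition with the constant of the factors. A ray
of the free product is determined up to equivalence by the ends of its projections to all cosets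
(`sameEnd_projRay`, `equiv_of_forall_sameEnd_projRay`).

The map `letterwise` commutes with these projections (`head_inv_mul_letterwise`). Hence "all
projections correspond" is a closed relation between the compact ray spaces of the two free
products. It is total on both sides by a limiting argument and respects equivalence of rays, so it
descends to a homeomorphism (`homeomorph_quotient_of_correspondence`).

Freedom in the choice of generating sets comes from stability of quasi-geodesics
(`FourPoint.morse`), through the same principle on closed relations. -/

namespace HypGroup

/-! ### Hyperbolic graph metrics: four points, slim triangles, stability of quasi-geodesics. -/

section GraphDist

variable {V V' : Type*}

/-- `d` is the path metric on the vertices of a connected graph. -/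
structure IsGraphDist (d : V → V → ℕ) : Prop where
  self : ∀ x, d x x = 0
  comm : ∀ x y, d x y = d y x
  tri : ∀ x y z, d x z ≤ d x y + d y z
  eq_of : ∀ x y, d x y = 0 → x = y
  geod : ∀ x y m, m ≤ d x y → ∃ z, d x z = m ∧ d z y + m = d x y

/-- Gromov's four-point condition. -/
def FourPoint (d : V → V → ℕ) (δ : ℕ) : Prop :=
  ∀ x y z w, d x y + d z w ≤ max (d x z + d y w) (d x w + d y z) + δ

/-- The union of all geodesics from `x` to `y`. -/
def Between (d : V → V → ℕ) (x y : V) : Set V := {w | d x w + d w y = d x y}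

/-- Geodesic triangles are `C`-slim. -/
def Slim (d : V → V → ℕ) (C : ℕ) : Prop :=
  ∀ x y z, ∀ w ∈ Between d x z, ∃ v, (v ∈ Between d x y ∨ v ∈ Between d y z) ∧ d w v ≤ C

theorem exists_linear_le_two_pow (A B : ℕ) : ∃ K, ∀ k, K ≤ k → A + B * k ≤ 2 ^ k := by
  refine ⟨2 * (A + 2 * B), fun k hk => ?_⟩
  obtain ⟨n, hn | hn⟩ : ∃ n, k = 2 * n ∨ k = 2 * n + 1 := ⟨k / 2, by omega⟩
  all_goals
    have h1 : n + 1 ≤ 2 ^ n := Nat.lt_two_pow_self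
    have h2 : (n + 1) * (n + 1) ≤ 2 ^ k := by
      calc (n + 1) * (n + 1) ≤ 2 ^ n * 2 ^ n := Nat.mul_le_mul h1 h1
        _ = 2 ^ (2 * n) := by rw [two_mul, pow_add]
        _ ≤ 2 ^ k := Nat.pow_le_pow_right (by norm_num) (by omega)
    have h3 : A + 2 * B ≤ n := by omega
    subst hn
    nlinarith

/-- In terms of Gromov products at `w`, bisecting a chain of `2 ^ k` steps costs one `δ` per level.
The loss is therefore logarithmic in the length of the chain, which is what the Morse lemma needs.
-/
theorem FourPoint.chain {d : V → V → ℕ} (hd : IsGraphDist d) {δ : ℕ} (h4 : FourPoint d δ)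
    (p : ℕ → V) (w : V) (c L k : ℕ) : ∀ i j, i ≤ j → j ≤ i + 2 ^ k →
    (∀ m, i ≤ m → m < j → d (p m) (p (m + 1)) ≤ L) →
    (∀ m, i ≤ m → m ≤ j → c + L ≤ 2 * d (p m) w) →
    c + d (p i) (p j) ≤ d (p i) w + d (p j) w + k * δ := by
  induction k with
  | zero =>
    intro i j hij hj hs hf
    have h1 := hf i le_rfl hij
    have h2 := hf j hij le_rfl
    rcases Nat.eq_or_lt_of_le hij with rfl | h
    · have := hd.self (p i); omega
    · obtain rfl : j = i + 1 := by simp at hj; omega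
      have := hs i le_rfl (by omega)
      omega
  | succ k ih =>
    intro i j hij hj hs hf
    have e : (k + 1) * δ = k * δ + δ := by ring
    rcases le_or_gt j (i + 2 ^ k) with h | h
    · have := ih i j hij h hs hf
      omega
    · have h1 := ih i (i + 2 ^ k) (by omega) le_rfl (fun m a b => hs m a (by omega))
        (fun m a b => hf m a (by omega))
      have h2 := ih (i + 2 ^ k) j (by omega) (by rw [pow_succ] at hj; omega)
        (fun m a b => hs m (by omega) b) (fun m a b => hf m (by omega) b)
      have h3 := h4 (p i) (p j) (p (i + 2 ^ k)) w
      have h5 := hd.comm (p (i + 2 ^ k)) (p j)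
      rcases max_cases (d (p i) (p (i + 2 ^ k)) + d (p j) w)
        (d (p i) w + d (p j) (p (i + 2 ^ k))) with h | h <;> omega

/-- A discrete path of length `N` that is bi-Lipschitz with constant `L`. -/
structure IsLipPath (d : V → V → ℕ) (L : ℕ) (p : ℕ → V) (N : ℕ) : Prop where
  le : ∀ i j, i ≤ j → j ≤ N → d (p i) (p j) ≤ L * (j - i)
  ge : ∀ i j, i ≤ j → j ≤ N → j - i ≤ L * d (p i) (p j)

theorem Between.left_mem {d : V → V → ℕ} (hd : IsGraphDist d) (x y : V) : x ∈ Between d x y := by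
  simp [Between, hd.self]

theorem Between.right_mem {d : V → V → ℕ} (hd : IsGraphDist d) (x y : V) : y ∈ Between d x y := by
  simp [Between, hd.self]

/-- Here `w` is a point of a geodesic at maximal distance `r` from the path. Going `2 * r` to either
side and then over to the path cuts off a piece of the path with at most `2 ^ k` steps that stays at
distance `r` from `w`. By `FourPoint.chain` its ends have a large Gromov product at `w`, whereas the
two points on the geodesic have product `0`. -/
theorem FourPoint.morse_aux {d : V → V → ℕ} (hd : IsGraphDist d) {δ : ℕ} (h4 : FourPoint d δ)
    {L N r k : ℕ} {p : ℕ → V} (hp : IsLipPath d L p N) {w : V} (hw : w ∈ Between d (p 0) (p N))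
    (hfar : ∀ i ≤ N, r ≤ d w (p i))
    (hnear : ∀ z ∈ Between d (p 0) (p N), ∃ i ≤ N, d z (p i) ≤ r)
    (hk : L * (6 * r) ≤ 2 ^ k) : 2 * r ≤ L + (k + 2) * δ := by
  -- If the endpoint `x` is closer than `2 * r`, it serves as `z` itself, being on the path. The
  -- last inequality says that the Gromov product of `z` and `p i` at `w` is at least `r`.
  have side : ∀ x : V, (∃ i ≤ N, x = p i) → (∀ z, d z x + d w z = d w x →
      z ∈ Between d (p 0) (p N)) →
      ∃ z, d z x + d w z = d w x ∧ ∃ i ≤ N, d z (p i) ≤ r ∧ d w z ≤ 2 * r ∧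
        2 * r + d (p i) z ≤ d w z + d w (p i) := by
    rintro x ⟨i, hi, rfl⟩ hx
    rcases le_or_gt (d w (p i)) (2 * r) with h | h
    · refine ⟨p i, by simp [hd.self], i, hi, by simp [hd.self], h, ?_⟩
      have := hfar i hi
      have := hd.self (p i)
      omega
    · obtain ⟨z, hz1, hz2⟩ := hd.geod w (p i) (2 * r) h.le
      obtain ⟨j, hj, hj2⟩ := hnear z (hx z (by omega))
      have := hfar j hj
      have := hd.comm z (p j)
      exact ⟨z, by omega, j, hj, hj2, by omega, by omega⟩
  simp only [Between, Set.mem_ofPred_eq] at hw side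
  have c1 := hd.comm w (p 0)
  obtain ⟨z1, a1, i, hi, a2, a3, a4⟩ := side (p 0) ⟨0, by omega, rfl⟩ (by
    intro z hz
    have := hd.tri z w (p N)
    have := hd.tri (p 0) z (p N)
    have := hd.comm z (p 0)
    have := hd.comm z w
    omega)
  obtain ⟨z2, b1, j, hj, b2, b3, b4⟩ := side (p N) ⟨N, le_rfl, rfl⟩ (by
    intro z hz
    have := hd.tri (p 0) w z
    have := hd.tri (p 0) z (p N)
    omega)
  have e0 : d w z1 + d w z2 ≤ d z1 z2 := by
    have := hd.tri (p 0) z1 (p N)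
    have := hd.tri z1 z2 (p N)
    have := hd.comm z1 (p 0)
    omega
  have e1 : d (p i) (p j) ≤ 6 * r := by
    have := hd.tri (p i) z1 (p j)
    have := hd.tri z1 w (p j)
    have := hd.tri w z2 (p j)
    have := hd.comm z1 (p i)
    have := hd.comm z1 w
    omega
  rcases le_or_gt (2 * r) L with hL | hL
  · omega
  have key : (2 * r - L) + d (p i) (p j) ≤ d (p i) w + d (p j) w + k * δ := by
    have main : ∀ i j, i ≤ j → j ≤ N → d (p i) (p j) ≤ 6 * r →
        (2 * r - L) + d (p i) (p j) ≤ d (p i) w + d (p j) w + k * δ := by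
      intro i j hij hj h6
      apply h4.chain hd p w (2 * r - L) L k i j hij
      · have h1 := hp.ge i j hij hj
        have h2 : L * d (p i) (p j) ≤ L * (6 * r) := Nat.mul_le_mul_left _ h6
        omega
      · intro m h1 h2
        have := hp.le m (m + 1) (by omega) (by omega)
        simpa using this
      · intro m h1 h2
        have := hfar m (by omega)
        rw [hd.comm] at this
        omega
    rcases le_total i j with h | h
    · exact main i j h hj e1
    · have := main j i h hi (by rw [hd.comm]; exact e1)
      have := hd.comm (p i) (p j)
      omega
  have c2 := hd.comm w (p i)
  have c3 := hd.comm w (p j)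
  have c4 := hd.comm w z1
  have c5 := hd.comm w z2
  have c6 := hd.comm (p j) z1
  have c7 := hd.comm (p j) z2
  have c8 := hd.comm (p i) z1
  -- The products along `z1`, `p i`, `p j`, `z2` are combined by two applications of the four-point
  -- condition; this is the `2` in `k + 2`.
  have f1 := h4 z1 (p j) (p i) w
  have f2 := h4 z1 z2 (p j) w
  have e : (k + 2) * δ = k * δ + 2 * δ := by ring
  have c9 := hd.comm (p j) (p i)
  rcases max_cases (d z1 (p i) + d (p j) w) (d z1 w + d (p j) (p i)) with h | h <;>
  rcases max_cases (d z1 (p j) + d z2 w) (d z1 w + d z2 (p j)) with h' | h' <;>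
  have c10 := hd.comm z2 (p j) <;> omega

theorem FourPoint.morse_near {d : V → V → ℕ} (hd : IsGraphDist d) {δ : ℕ} (h4 : FourPoint d δ)
    (L : ℕ) : ∃ D, ∀ N p, IsLipPath d L p N → ∀ w ∈ Between d (p 0) (p N),
      ∃ k ≤ N, d w (p k) ≤ D := by
  -- If `k = q + 1` is the logarithm of `6 * L * r`, then `morse_aux` bounds `6 * L * r` by the
  -- linear function of `q` written here, while `6 * L * r` exceeds `2 ^ q`. This is impossible for
  -- `q ≥ K`.
  obtain ⟨K, hK⟩ := exists_linear_le_two_pow (L * (3 * (L + 3 * δ))) (L * (3 * δ))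
  refine ⟨L + (K + 3) * δ, fun N p hp w hw => ?_⟩
  classical
  by_contra! hcon
  have hex : ∃ r, ∃ w ∈ Between d (p 0) (p N), ∀ i ≤ N, r ≤ d w (p i) :=
    ⟨0, w, hw, by simp⟩
  have hbd : ∀ r, (∃ w ∈ Between d (p 0) (p N), ∀ i ≤ N, r ≤ d w (p i)) →
      r ≤ d (p 0) (p N) := by
    rintro r ⟨w, hw, h⟩
    have := h 0 (by omega)
    have := hd.comm w (p 0)
    simp only [Between, Set.mem_ofPred_eq] at hw
    omega
  set P : ℕ → Prop := fun r => ∃ w ∈ Between d (p 0) (p N), ∀ i ≤ N, r ≤ d w (p i) with hP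
  set r := Nat.findGreatest P (d (p 0) (p N)) with hr
  have hPr : P r := Nat.findGreatest_spec (P := P) (m := 0) (by omega) ⟨w, hw, by simp⟩
  have hge : ∀ s, P s → s ≤ r := fun s hs => Nat.le_findGreatest (hbd s hs) hs
  have hlt : L + (K + 3) * δ < r :=
    hge (L + (K + 3) * δ + 1) ⟨w, hw, fun i hi => hcon i hi⟩
  obtain ⟨w', hw', hfar⟩ := hPr
  have hnear : ∀ z ∈ Between d (p 0) (p N), ∃ i ≤ N, d z (p i) ≤ r := by
    intro z hz
    by_contra! hc
    have := hge (r + 1) ⟨z, hz, fun i hi => hc i hi⟩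
    omega
  set k := Nat.clog 2 (L * (6 * r)) with hk
  have h1 : L * (6 * r) ≤ 2 ^ k := Nat.le_pow_clog (by norm_num) _
  have h2 := h4.morse_aux hd hp hw' hfar hnear h1
  have h3 : k ≤ K + 1 := by
    by_contra! hc
    obtain ⟨q, hq⟩ : ∃ q, k = q + 1 := ⟨k - 1, by omega⟩
    have h5 := hK q (by omega)
    have h6 : 2 ^ q < L * (6 * r) := by
      have := Nat.pow_pred_clog_lt_self (b := 2) (by norm_num) (x := L * (6 * r)) (by
        by_contra! h0
        have : k = 0 := Nat.clog_of_right_le_one h0 2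
        omega)
      rw [← hk, hq] at this
      simpa using this
    rw [hq] at h2
    have h7 : L * (6 * r) ≤ L * (3 * (L + (q + 1 + 2) * δ)) := by
      apply Nat.mul_le_mul_left
      omega
    have e : L * (3 * (L + (q + 1 + 2) * δ)) = L * (3 * (L + 3 * δ)) + L * (3 * δ) * q := by ring
    omega
  have h8 : (k + 2) * δ ≤ (K + 3) * δ := Nat.mul_le_mul_right _ (by omega)
  omega

/-- Take the last geodesic point `w` that is `D`-close to the path at some time `s ≤ k`. Its
successor is `D`-close to the path at a time `s' ≥ k`. Then `p s` and `p s'` are at distance at most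
`2 * D + 1`, so `s' - s` is bounded and `p k` is trapped between them. -/
theorem exists_between_near_of_near {d : V → V → ℕ} (hd : IsGraphDist d) {L D N : ℕ} {p : ℕ → V}
    (hp : IsLipPath d L p N) (hD : ∀ w ∈ Between d (p 0) (p N), ∃ k ≤ N, d w (p k) ≤ D)
    {k : ℕ} (hk : k ≤ N) :
    ∃ w ∈ Between d (p 0) (p N), d w (p k) ≤ L * (L * (2 * D + 1)) + D := by
  classical
  set P : ℕ → Prop := fun t => ∃ w ∈ Between d (p 0) (p N), d (p 0) w = t ∧
    ∃ s ≤ k, d w (p s) ≤ D with hP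
  obtain ⟨w, hw, hwt, s, hs, hsD⟩ : P (Nat.findGreatest P (d (p 0) (p N))) :=
    Nat.findGreatest_spec (P := P) (m := 0) (by omega)
      ⟨p 0, Between.left_mem hd _ _, hd.self _, 0, by omega, by simp [hd.self]⟩
  have hmax : ∀ t, P t → t ≤ d (p 0) w := by
    rintro t ⟨v, hv, hvt, h⟩
    rw [hwt]
    refine Nat.le_findGreatest ?_ ⟨v, hv, hvt, h⟩
    simp only [Between, Set.mem_ofPred_eq] at hv
    omega
  have key : ∃ s', k ≤ s' ∧ s' ≤ N ∧ d w (p s') ≤ D + 1 := by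
    rcases Nat.eq_zero_or_pos (d w (p N)) with h0 | h0
    · exact ⟨N, hk, le_rfl, by omega⟩
    · obtain ⟨w', h1, h2⟩ := hd.geod w (p N) 1 h0
      simp only [Between, Set.mem_ofPred_eq] at hw
      have t1 := hd.tri (p 0) w w'
      have t2 := hd.tri (p 0) w' (p N)
      have hw' : w' ∈ Between d (p 0) (p N) := by
        simp only [Between, Set.mem_ofPred_eq]; omega
      obtain ⟨s', hs', hs'D⟩ := hD w' hw'
      refine ⟨s', ?_, hs', ?_⟩
      · by_contra! hc
        have := hmax _ ⟨w', hw', rfl, s', hc.le, hs'D⟩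
        omega
      · have := hd.tri w w' (p s')
        omega
  obtain ⟨s', hs1, hs2, hs3⟩ := key
  refine ⟨w, hw, ?_⟩
  have t1 := hd.tri (p s) w (p s')
  have t2 := hd.comm (p s) w
  have t3 := hp.ge s s' (by omega) hs2
  have t4 := hp.le s k hs hk
  have t5 := hd.tri w (p s) (p k)
  have t6 : L * d (p s) (p s') ≤ L * (2 * D + 1) := Nat.mul_le_mul_left _ (by omega)
  have t7 : L * (k - s) ≤ L * (L * (2 * D + 1)) := Nat.mul_le_mul_left _ (by omega)
  omega

/-- Stability of quasi-geodesics. -/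
theorem FourPoint.morse {d : V → V → ℕ} (hd : IsGraphDist d) {δ : ℕ} (h4 : FourPoint d δ)
    (L : ℕ) : ∃ D, ∀ N p, IsLipPath d L p N →
      (∀ w ∈ Between d (p 0) (p N), ∃ k ≤ N, d w (p k) ≤ D) ∧
      ∀ k ≤ N, ∃ w ∈ Between d (p 0) (p N), d w (p k) ≤ D := by
  obtain ⟨D, hD⟩ := h4.morse_near hd L
  refine ⟨L * (L * (2 * D + 1)) + D, fun N p hp => ⟨fun w hw => ?_, fun k hk => ?_⟩⟩
  · obtain ⟨k, hk, h⟩ := hD N p hp w hw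
    exact ⟨k, hk, by omega⟩
  · exact exists_between_near_of_near hd hp (hD N p hp) hk

/-- The four-point condition for the three vertices and `w` shows that `w` almost realises equality
in the triangle inequality on one of the other sides; such a point is close to that side. -/
theorem FourPoint.slim {d : V → V → ℕ} (hd : IsGraphDist d) {δ : ℕ} (h4 : FourPoint d δ) :
    Slim d (2 * δ) := by
  have near : ∀ x y w, d x w + d w y ≤ d x y + δ → ∃ v ∈ Between d x y, d w v ≤ 2 * δ := by
    intro x y w h
    rcases le_or_gt (d x w) (d x y) with hle | hlt
    · obtain ⟨v, h1, h2⟩ := hd.geod x y (d x w) hle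
      refine ⟨v, by simp only [Between, Set.mem_ofPred_eq]; omega, ?_⟩
      have h3 := h4 w v x y
      have := hd.comm w x
      have := hd.comm v x
      rcases max_cases (d w x + d v y) (d w y + d v x) with h | h <;> omega
    · exact ⟨y, Between.right_mem hd _ _, by omega⟩
  intro x y z w hw
  have h1 := h4 x z y w
  simp only [Between, Set.mem_ofPred_eq] at hw
  have := hd.comm z w
  have := hd.comm z y
  have := hd.comm y w
  rcases max_cases (d x y + d z w) (d x w + d z y) with h | h
  · obtain ⟨v, hv, hv'⟩ := near x y w (by omega)
    exact ⟨v, Or.inl hv, hv'⟩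
  · obtain ⟨v, hv, hv'⟩ := near y z w (by omega)
    exact ⟨v, Or.inr hv, hv'⟩

/-- A point of a geodesic from `x` to `z` where closeness to the side `x w` turns into closeness to
the side `w z` has distance to `w` at most the Gromov product plus `2 * C + 1`. -/
theorem Slim.exists_between_gromovProduct {d : V → V → ℕ} (hd : IsGraphDist d) {C : ℕ}
    (hC : Slim d C) (w x z : V) :
    ∃ u ∈ Between d x z, 2 * d w u + d x z ≤ d w x + d w z + (4 * C + 2) := by
  classical
  set P : ℕ → Prop := fun t => ∃ u ∈ Between d x z, d x u = t ∧
    ∃ v ∈ Between d x w, d u v ≤ C with hP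
  obtain ⟨u, hu, hut, v, hv, huv⟩ : P (Nat.findGreatest P (d x z)) :=
    Nat.findGreatest_spec (P := P) (m := 0) (by omega)
      ⟨x, Between.left_mem hd _ _, hd.self _, x, Between.left_mem hd _ _, by simp [hd.self]⟩
  have hmax : ∀ t, P t → t ≤ d x u := by
    rintro t ⟨v, hv, hvt, h⟩
    rw [hut]
    refine Nat.le_findGreatest ?_ ⟨v, hv, hvt, h⟩
    simp only [Between, Set.mem_ofPred_eq] at hv
    omega
  have key : ∃ u', d u' z ≤ d u z ∧ d u u' ≤ 1 ∧ ∃ v' ∈ Between d w z, d u' v' ≤ C ∧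
      d u z ≤ d u' z + 1 := by
    rcases Nat.eq_zero_or_pos (d u z) with h0 | h0
    · obtain rfl := hd.eq_of _ _ h0
      exact ⟨u, le_rfl, by simp [hd.self], u, Between.right_mem hd _ _, by simp [hd.self],
        by omega⟩
    · obtain ⟨u', h1, h2⟩ := hd.geod u z 1 h0
      simp only [Between, Set.mem_ofPred_eq] at hu
      have t1 := hd.tri x u u'
      have t2 := hd.tri x u' z
      have hu' : u' ∈ Between d x z := by
        simp only [Between, Set.mem_ofPred_eq]; omega
      obtain ⟨v', hv' | hv', hd'⟩ := hC x w z u' hu'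
      · have := hmax _ ⟨u', hu', rfl, v', hv', hd'⟩
        omega
      · exact ⟨u', by omega, by omega, v', hv', hd', by omega⟩
  obtain ⟨u', h1, h2, v', hv', h3, h4⟩ := key
  refine ⟨u, hu, ?_⟩
  simp only [Between, Set.mem_ofPred_eq] at hu hv hv'
  have := hd.tri w v u
  have := hd.tri x v u
  have := hd.tri w v' u'
  have := hd.tri u' v' z
  have := hd.tri w u' u
  have := hd.comm w v
  have := hd.comm w x
  have := hd.comm u v
  have := hd.comm u' v'
  have := hd.comm u u'
  omega

/-- A point realising the Gromov product of `x` and `y` at `w` is `C`-close to a geodesic `x z` or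
`z y`, and the distance from `w` to any point of a geodesic bounds the Gromov product of its ends
from above. -/
theorem Slim.fourPoint {d : V → V → ℕ} (hd : IsGraphDist d) {C : ℕ} (hC : Slim d C) :
    FourPoint d (6 * C + 2) := by
  intro x y z w
  obtain ⟨u, hu, h⟩ := hC.exists_between_gromovProduct hd w x y
  obtain ⟨v, hv, huv⟩ := hC x z y u hu
  have := hd.tri w u v
  have := hd.comm w z
  have := hd.comm w y
  have := hd.comm w x
  have := hd.comm y z
  have := hd.comm x v
  have := hd.comm v z
  have t1 := hd.tri w v x
  have t2 := hd.tri w v y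
  have t3 := hd.tri w v z
  have := le_max_left (d x z + d y w) (d x w + d y z)
  have := le_max_right (d x z + d y w) (d x w + d y z)
  simp only [Between, Set.mem_ofPred_eq] at hv
  rcases hv with hv | hv <;> omega

theorem IsGraphDist.exists_geodesic {d : V → V → ℕ} (hd : IsGraphDist d) (x y : V) :
    ∃ p : ℕ → V, p 0 = x ∧ p (d x y) = y ∧ ∀ i j, i ≤ j → j ≤ d x y → d (p i) (p j) + i = j := by
  suffices H : ∀ n x, d x y = n → ∃ p : ℕ → V, p 0 = x ∧ p n = y ∧
      ∀ i, i < n → d (p i) (p (i + 1)) ≤ 1 by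
    obtain ⟨p, h0, h1, h2⟩ := H _ x rfl
    have h3 : ∀ k i, i + k ≤ d x y → d (p i) (p (i + k)) ≤ k := by
      intro k
      induction k with
      | zero => intro i _; simp [hd.self]
      | succ k ih =>
        intro i hi
        have := ih i (by omega)
        have := h2 (i + k) (by omega)
        have := hd.tri (p i) (p (i + k)) (p (i + k + 1))
        rw [← add_assoc]
        omega
    refine ⟨p, h0, h1, fun i j hij hj => ?_⟩
    have a := h3 i 0 (by omega)
    have b := h3 (j - i) i (by omega)
    have c := h3 (d x y - j) j (by omega)
    rw [show 0 + i = i by omega, h0] at a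
    rw [show i + (j - i) = j by omega] at b
    rw [show j + (d x y - j) = d x y by omega, h1] at c
    have := hd.tri x (p i) y
    have := hd.tri (p i) (p j) y
    omega
  intro n
  induction n with
  | zero =>
    intro x hx
    exact ⟨fun _ => x, rfl, hd.eq_of _ _ hx, by simp⟩
  | succ n ih =>
    intro x hx
    obtain ⟨z, h1, h2⟩ := hd.geod x y 1 (by omega)
    obtain ⟨p, a, b, c⟩ := ih z (by omega)
    refine ⟨fun i => Nat.casesOn i x p, rfl, b, fun i hi => ?_⟩
    cases i with
    | zero => simp [a, h1]
    | succ i => exact c i (by omega)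

theorem IsGraphDist.exists_geodesic_through {d : V → V → ℕ} (hd : IsGraphDist d) {x y w : V}
    (hw : w ∈ Between d x y) :
    ∃ p : ℕ → V, p 0 = x ∧ p (d x y) = y ∧ (∀ i j, i ≤ j → j ≤ d x y → d (p i) (p j) + i = j) ∧
      p (d x w) = w := by
  obtain ⟨p, p0, p1, p2⟩ := hd.exists_geodesic x w
  obtain ⟨q, q0, q1, q2⟩ := hd.exists_geodesic w y
  simp only [Between, Set.mem_ofPred_eq] at hw
  set P : ℕ → V := fun i => if i ≤ d x w then p i else q (i - d x w) with hP
  have P1 : ∀ i, i ≤ d x w → P i = p i := fun i hi => by simp [hP, hi]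
  have P2 : ∀ i, d x w ≤ i → P i = q (i - d x w) := fun i hi => by
    rcases Nat.eq_or_lt_of_le hi with rfl | h
    · simp [hP, p1, q0]
    · simp [hP, Nat.not_le.2 h]
  have e1 : P 0 = x := by rw [P1 _ (by omega), p0]
  have e2 : P (d x y) = y := by rw [P2 _ (by omega), show d x y - d x w = d w y by omega, q1]
  refine ⟨P, e1, e2, fun i j hij hj => ?_, by rw [P1 _ le_rfl, p1]⟩
  rcases le_total j (d x w) with h | h
  · rw [P1 _ h, P1 _ (by omega)]
    exact p2 i j hij h
  rcases le_total i (d x w) with h' | h'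
  · rw [P1 _ h', P2 _ h]
    have a1 := p2 0 i (by omega) h'
    have a2 := p2 i _ h' le_rfl
    have b1 := q2 0 (j - d x w) (by omega) (by omega)
    have b2 := q2 (j - d x w) (d w y) (by omega) (by omega)
    rw [p0] at a1
    rw [p1] at a2
    rw [q0] at b1
    rw [q1] at b2
    have := hd.tri (p i) w (q (j - d x w))
    have := hd.tri x (p i) y
    have := hd.tri (p i) (q (j - d x w)) y
    omega
  · rw [P2 _ h, P2 _ h']
    have := q2 (i - d x w) (j - d x w) (by omega) (by omega)
    omega

theorem IsLipPath.of_geodesic {d : V → V → ℕ} {d' : V' → V' → ℕ} {L : ℕ} {φ : V' → V}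
    (h1 : ∀ x y, d (φ x) (φ y) ≤ L * d' x y) (h2 : ∀ x y, d' x y ≤ L * d (φ x) (φ y))
    {p : ℕ → V'} {N : ℕ} (hp : ∀ i j, i ≤ j → j ≤ N → d' (p i) (p j) + i = j) :
    IsLipPath d L (fun i => φ (p i)) N := by
  refine ⟨fun i j hij hj => ?_, fun i j hij hj => ?_⟩
  · have := hp i j hij hj
    rw [show j - i = d' (p i) (p j) by omega]
    exact h1 _ _
  · have := hp i j hij hj
    rw [show j - i = d' (p i) (p j) by omega]
    exact h2 _ _

/-- Geodesic triangles map to quasi-geodesic triangles, which are close to geodesic ones. Slimness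
of the latter is pulled back, since slimness, unlike the four-point inequality, survives a
multiplicative distortion. -/
theorem FourPoint.of_biLipschitz {d : V → V → ℕ} (hd : IsGraphDist d) {d' : V' → V' → ℕ}
    (hd' : IsGraphDist d') {δ L : ℕ} (h4 : FourPoint d δ) {φ : V' → V}
    (h1 : ∀ x y, d (φ x) (φ y) ≤ L * d' x y) (h2 : ∀ x y, d' x y ≤ L * d (φ x) (φ y)) :
    ∃ δ', FourPoint d' δ' := by
  obtain ⟨D, hD⟩ := h4.morse hd L
  suffices H : Slim d' (L * (D + 2 * δ + D)) from ⟨_, H.fourPoint hd'⟩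
  have back : ∀ x y v, v ∈ Between d (φ x) (φ y) → ∃ u ∈ Between d' x y, d v (φ u) ≤ D := by
    intro x y v hv
    obtain ⟨q, q0, q1, q2⟩ := hd'.exists_geodesic x y
    have hq := hD _ _ (IsLipPath.of_geodesic h1 h2 q2)
    simp only [q0, q1] at hq
    obtain ⟨k, hk, h⟩ := hq.1 v hv
    refine ⟨q k, ?_, h⟩
    have a := q2 0 k (by omega) hk
    have b := q2 k _ hk le_rfl
    rw [q0] at a
    rw [q1] at b
    simp only [Between, Set.mem_ofPred_eq]
    omega
  intro x y z w hw
  obtain ⟨p, p0, p1, p2, p3⟩ := hd'.exists_geodesic_through hw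
  have hp := hD _ _ (IsLipPath.of_geodesic h1 h2 p2)
  simp only [p0, p1] at hp
  obtain ⟨v, hv, hvD⟩ := hp.2 (d' x w) (by simp only [Between, Set.mem_ofPred_eq] at hw; omega)
  rw [p3] at hvD
  obtain ⟨v', hv', hvv'⟩ := (h4.slim hd) (φ x) (φ y) (φ z) v hv
  have : ∃ u, (u ∈ Between d' x y ∨ u ∈ Between d' y z) ∧ d v' (φ u) ≤ D := by
    rcases hv' with h | h
    · obtain ⟨u, hu, h⟩ := back _ _ _ h
      exact ⟨u, Or.inl hu, h⟩
    · obtain ⟨u, hu, h⟩ := back _ _ _ h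
      exact ⟨u, Or.inr hu, h⟩
  obtain ⟨u, hu, huD⟩ := this
  refine ⟨u, hu, (h2 w u).trans (Nat.mul_le_mul_left _ ?_)⟩
  have := hd.tri (φ w) v (φ u)
  have := hd.tri v v' (φ u)
  have := hd.comm (φ w) v
  omega

end GraphDist

end HypGroup

namespace HypGroup

open Filter Topology

/-! ### Word metrics. -/

section WordMetric

variable {G : Type*} [Group G] {S : Set G}

/-- The word norm: the word distance to the identity. -/
noncomputable def wordNorm (S : Set G) (g : G) : ℕ := wordDist S 1 g

theorem wordDist_self (x : G) : wordDist S x x = 0 := SimpleGraph.dist_self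

theorem wordDist_comm (x y : G) : wordDist S x y = wordDist S y x := SimpleGraph.dist_comm

theorem wordNorm_one : wordNorm S 1 = 0 := wordDist_self 1

theorem connected_mulCayley (hS : Subgroup.closure S = ⊤) :
    (SimpleGraph.mulCayley S).Connected := by
  have step : ∀ x : G, ∀ s ∈ S, (SimpleGraph.mulCayley S).Reachable x (x * s) := by
    intro x s hs
    by_cases h : x = x * s
    · rw [← h]
    · exact SimpleGraph.Adj.reachable ((SimpleGraph.mulCayley_adj' S _ _).2 ⟨h, s, hs, Or.inl rfl⟩)
  have key : ∀ g : G, ∀ x, (SimpleGraph.mulCayley S).Reachable x (x * g) := by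
    intro g
    have hg : g ∈ Subgroup.closure S := hS ▸ Subgroup.mem_top g
    induction hg using Subgroup.closure_induction with
    | mem s hs => exact fun x => step x s hs
    | one => intro x; rw [mul_one]
    | mul a b _ _ ha hb => intro x; rw [← mul_assoc]; exact (ha x).trans (hb _)
    | inv a _ ha => intro x; have := (ha (x * a⁻¹)).symm; rwa [inv_mul_cancel_right] at this
  refine ⟨fun x y => ?_⟩
  have := key (x⁻¹ * y) x
  rwa [mul_inv_cancel_left] at this

theorem wordDist_mul_left (g x y : G) : wordDist S (g * x) (g * y) = wordDist S x y := by
  have h : ∀ (g x y : G), (SimpleGraph.mulCayley S).edist (g * x) (g * y) ≤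
      (SimpleGraph.mulCayley S).edist x y := by
    intro g x y
    unfold SimpleGraph.edist
    refine le_iInf fun w => ?_
    let f : SimpleGraph.mulCayley S →g SimpleGraph.mulCayley S :=
      ⟨fun a => g * a, fun h => (SimpleGraph.mulCayley_adj_mul_iff_right).2 h⟩
    refine (iInf_le _ (w.map f)).trans ?_
    simp
  have h2 := h g⁻¹ (g * x) (g * y)
  simp only [inv_mul_cancel_left] at h2
  unfold wordDist SimpleGraph.dist
  rw [le_antisymm (h g x y) h2]

theorem wordDist_eq (x y : G) : wordDist S x y = wordNorm S (x⁻¹ * y) := by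
  rw [wordNorm, ← wordDist_mul_left x⁻¹, inv_mul_cancel]

theorem wordNorm_inv (x : G) : wordNorm S x⁻¹ = wordNorm S x := by
  have := wordDist_eq (S := S) x 1
  rw [mul_one] at this
  rw [← this, wordDist_comm, wordNorm]

theorem wordDist_le_one_of_adj {x y : G} (h : (SimpleGraph.mulCayley S).Adj x y) :
    wordDist S x y ≤ 1 := (SimpleGraph.dist_eq_one_iff_adj.2 h).le

theorem wordNorm_le_one {s : G} (hs : s ∈ S) : wordNorm S s ≤ 1 := by
  by_cases h : (1 : G) = s
  · rw [← h, wordNorm_one]; omega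
  · exact wordDist_le_one_of_adj ((SimpleGraph.mulCayley_adj' S _ _).2 ⟨h, s, hs, by simp⟩)

theorem isGraphDist_wordDist (hS : Subgroup.closure S = ⊤) : IsGraphDist (wordDist S) where
  self := wordDist_self
  comm := wordDist_comm
  tri x y z := (connected_mulCayley hS).dist_triangle
  eq_of x y h := (connected_mulCayley hS).dist_eq_zero_iff.1 h
  geod x y m hm := by
    obtain ⟨p, hp⟩ := (connected_mulCayley hS).exists_walk_length_eq_dist x y
    unfold wordDist at hm ⊢
    have h1 := SimpleGraph.dist_le (p.take m)
    have h2 := SimpleGraph.dist_le (p.drop m)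
    have h3 := (connected_mulCayley hS).dist_triangle (u := x) (v := p.getVert m) (w := y)
    have h4 : (p.take m).length = m := by
      simp; omega
    have h5 : (p.drop m).length = p.length - m := by
      simp
    exact ⟨p.getVert m, by omega, by omega⟩

theorem le_add_mul_wordDist (hS : Subgroup.closure S = ⊤) (D : G → ℕ) (c : ℕ)
    (h : ∀ x, ∀ s ∈ S, D (x * s) ≤ D x + c ∧ D x ≤ D (x * s) + c) (x y : G) :
    D y ≤ D x + c * wordDist S x y := by
  obtain ⟨p, hp⟩ := (connected_mulCayley hS).exists_walk_length_eq_dist x y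
  unfold wordDist
  rw [← hp]
  clear hp
  induction p with
  | nil => simp
  | @cons u v w hadj p ih =>
    rw [SimpleGraph.Walk.length_cons, mul_add]
    obtain ⟨-, s, hs, rfl | rfl⟩ := (SimpleGraph.mulCayley_adj' S _ _).1 hadj
    · exact ih.trans (by have := (h u s hs).1; omega)
    · exact ih.trans (by have := (h v s hs).2; omega)

theorem finite_wordNorm_le (hS : IsFiniteGeneratingSet S) (n : ℕ) :
    {g : G | wordNorm S g ≤ n}.Finite := by
  have hd := isGraphDist_wordDist hS.2
  induction n with
  | zero =>
    refine (Set.finite_singleton (1 : G)).subset fun g hg => ?_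
    exact (hd.eq_of _ _ (Nat.le_zero.1 hg)).symm
  | succ n ih =>
    refine (ih.union ((ih.image2 (fun a b => a * b) hS.1).union
      (ih.image2 (fun a b => a * b⁻¹) hS.1))).subset fun g hg => ?_
    rcases Nat.lt_or_ge (wordNorm S g) (n + 1) with h | h
    · exact Or.inl (Nat.lt_succ_iff.1 h)
    · obtain ⟨z, h1, h2⟩ := hd.geod 1 g n (by simp only [wordNorm] at h; omega)
      have h3 : wordDist S z g = 1 := by
        have : wordDist S 1 g ≤ n + 1 := hg
        simp only [wordNorm] at h; omega
      obtain ⟨-, s, hs, e | e⟩ :=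
        (SimpleGraph.mulCayley_adj' S _ _).1 (SimpleGraph.dist_eq_one_iff_adj.1 h3)
      · exact Or.inr (Or.inl ⟨z, h1.le, s, hs, e⟩)
      · exact Or.inr (Or.inr ⟨z, h1.le, s, hs, by simp [e]⟩)

theorem wordNorm_mul_le (hS : Subgroup.closure S = ⊤) (x y : G) :
    wordNorm S (x * y) ≤ wordNorm S x + wordNorm S y := by
  have := (isGraphDist_wordDist hS).tri 1 x (x * y)
  rwa [wordDist_eq x (x * y), inv_mul_cancel_left] at this

theorem wordNorm_eq_zero (hS : Subgroup.closure S = ⊤) {x : G} (h : wordNorm S x = 0) : x = 1 :=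
  ((isGraphDist_wordDist hS).eq_of _ _ h).symm

theorem exists_lipschitz {H : Type*} [Group H] {T : Set H} (hS : IsFiniteGeneratingSet S)
    (hT : IsFiniteGeneratingSet T) (φ : G →* H) :
    ∃ L, ∀ x y, wordDist T (φ x) (φ y) ≤ L * wordDist S x y := by
  obtain ⟨L, hL⟩ := (hS.1.image fun s => wordNorm T (φ s)).bddAbove
  refine ⟨L, fun x y => ?_⟩
  have key := le_add_mul_wordDist hS.2 (fun z => wordDist T (φ x) (φ z)) L (fun z s hs => ?_) x y
  · simpa [wordDist_self] using key
  · have h1 : wordNorm T (φ s) ≤ L := hL ⟨s, hs, rfl⟩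
    have h2 : wordDist T (φ z) (φ (z * s)) ≤ L := by
      rwa [wordDist_eq, map_mul, inv_mul_cancel_left]
    have hd := isGraphDist_wordDist hT.2
    have := hd.tri (φ x) (φ z) (φ (z * s))
    have := hd.tri (φ x) (φ (z * s)) (φ z)
    have := hd.comm (φ z) (φ (z * s))
    omega

end WordMetric

/-! ### Finite and infinite geodesics from the identity, and their limits. -/

section Rays

theorem tendsto_nhds_induced_pi {α X T : Type*} (v : X → ℕ → α) (f : T → X) (F : Filter T) (x : X) :
    Tendsto f F (@nhds X (TopologicalSpace.induced v
      (@Pi.topologicalSpace ℕ (fun _ => α) (fun _ => ⊥))) x) ↔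
      ∀ n, ∀ᶠ t in F, v (f t) n = v x n := by
  let _ : TopologicalSpace α := ⊥
  have : DiscreteTopology α := ⟨rfl⟩
  rw [nhds_induced, tendsto_comap_iff, tendsto_pi_nhds]
  simp only [nhds_discrete, tendsto_pure, Function.comp]

variable {G : Type*} [Group G] {S : Set G}

/-- Geodesics in the Cayley graph from the identity, finite or infinite; the finite ones are
extended by a constant sequence. -/
def GenRay (S : Set G) : Type _ :=
  {ρ : ℕ → G // ρ 0 = 1 ∧ ∀ n, ρ (n + 1) = ρ n ∨
    (wordNorm S (ρ (n + 1)) = n + 1 ∧ wordDist S (ρ n) (ρ (n + 1)) ≤ 1)}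

instance (S : Set G) : TopologicalSpace (GenRay S) :=
  TopologicalSpace.induced Subtype.val (@Pi.topologicalSpace ℕ (fun _ => G) (fun _ => ⊥))

theorem GenRay.tendsto_iff {T : Type*} {f : T → GenRay S} {F : Filter T} {ρ : GenRay S} :
    Tendsto f F (𝓝 ρ) ↔ ∀ n, ∀ᶠ t in F, (f t).1 n = ρ.1 n :=
  tendsto_nhds_induced_pi Subtype.val f F ρ

theorem GeodesicRay.tendsto_iff {T : Type*} {f : T → GeodesicRay S} {F : Filter T}
    {ρ : GeodesicRay S} : Tendsto f F (𝓝 ρ) ↔ ∀ n, ∀ᶠ t in F, (f t).1 n = ρ.1 n :=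
  tendsto_nhds_induced_pi Subtype.val f F ρ

/-- Balls are finite, so an ultrafilter selects one value in each coordinate; this replaces the
diagonal argument of Arzelà–Ascoli. -/
theorem exists_pointwise_limit (hS : IsFiniteGeneratingSet S) {T : Type*} (u : Ultrafilter T)
    (v : T → ℕ → G) (hv : ∀ t n, wordNorm S (v t n) ≤ n) :
    ∃ ρ : ℕ → G, ∀ n, ∀ᶠ t in u, v t n = ρ n := by
  have : ∀ n, ∃ g, ∀ᶠ t in u, v t n = g := by
    intro n
    have h := (Ultrafilter.finite_biUnion_mem_iff (f := u) (finite_wordNorm_le hS n)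
      (s := fun g => {t | v t n = g})).1 (by
        filter_upwards with t
        simp only [Set.mem_iUnion]
        exact ⟨v t n, hv t n, rfl⟩)
    obtain ⟨g, -, hg⟩ := h
    exact ⟨g, hg⟩
  choose ρ hρ using this
  exact ⟨ρ, hρ⟩

namespace GenRay

theorem norm_le (ρ : GenRay S) (n : ℕ) : wordNorm S (ρ.1 n) ≤ n := by
  induction n with
  | zero => rw [ρ.2.1, wordNorm_one]
  | succ n ih =>
    rcases ρ.2.2 n with h | h
    · rw [h]; omega
    · omega

theorem eq_of_norm_lt (hS : IsFiniteGeneratingSet S) (ρ : GenRay S) {n : ℕ}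
    (h : wordNorm S (ρ.1 n) < n) {m : ℕ} (hm : n ≤ m) : ρ.1 m = ρ.1 n := by
  induction m, hm using Nat.le_induction with
  | base => rfl
  | succ m hm ih =>
    rcases ρ.2.2 m with h' | ⟨h1, h2⟩
    · rw [h', ih]
    · exfalso
      have := (isGraphDist_wordDist hS.2).tri 1 (ρ.1 m) (ρ.1 (m + 1))
      rw [ih] at this h2
      simp only [wordNorm] at h h1
      omega

theorem dist_le (hS : IsFiniteGeneratingSet S) (ρ : GenRay S) (n k : ℕ) :
    wordDist S (ρ.1 n) (ρ.1 (n + k)) ≤ k := by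
  induction k with
  | zero => simp [wordDist_self]
  | succ k ih =>
    have := (isGraphDist_wordDist hS.2).tri (ρ.1 n) (ρ.1 (n + k)) (ρ.1 (n + (k + 1)))
    have : wordDist S (ρ.1 (n + k)) (ρ.1 (n + (k + 1))) ≤ 1 := by
      rcases ρ.2.2 (n + k) with h | h
      · rw [← add_assoc, h, wordDist_self]; omega
      · exact h.2
    omega

/-- The generalized ray is a geodesic from the identity to `g`. -/
def EndsAt (ρ : GenRay S) (g : G) : Prop := ∃ N, ∀ n, N ≤ n → ρ.1 n = g

/-- The generalized ray is a geodesic ray. -/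
def IsInfinite (ρ : GenRay S) : Prop := ∀ n, wordNorm S (ρ.1 n) = n

theorem isInfinite_or_endsAt (hS : IsFiniteGeneratingSet S) (ρ : GenRay S) :
    ρ.IsInfinite ∨ ∃ g, ρ.EndsAt g := by
  by_cases h : ρ.IsInfinite
  · exact Or.inl h
  · simp only [IsInfinite, not_forall] at h
    obtain ⟨n, hn⟩ := h
    have := ρ.norm_le n
    exact Or.inr ⟨ρ.1 n, n, fun m hm => ρ.eq_of_norm_lt hS (by omega) hm⟩

theorem EndsAt.not_isInfinite {ρ : GenRay S} {g : G} (h : ρ.EndsAt g) : ¬ ρ.IsInfinite := by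
  obtain ⟨N, hN⟩ := h
  intro hi
  have h1 := hi N
  have h2 := hi (N + 1)
  rw [hN N le_rfl] at h1
  rw [hN (N + 1) (by omega)] at h2
  omega

theorem EndsAt.unique {ρ : GenRay S} {g g' : G} (h : ρ.EndsAt g) (h' : ρ.EndsAt g') : g = g' := by
  obtain ⟨N, hN⟩ := h
  obtain ⟨N', hN'⟩ := h'
  rw [← hN (max N N') (le_max_left _ _), hN' _ (le_max_right _ _)]

theorem EndsAt.apply (hS : IsFiniteGeneratingSet S) {ρ : GenRay S} {g : G} (h : ρ.EndsAt g)
    {n : ℕ} (hn : wordNorm S g ≤ n) : ρ.1 n = g := by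
  classical
  have hex : ∃ m, wordNorm S (ρ.1 m) < m := by
    obtain ⟨N, hN⟩ := h
    refine ⟨max N (wordNorm S g + 1), ?_⟩
    rw [hN _ (le_max_left _ _)]
    exact lt_of_lt_of_le (Nat.lt_succ_self _) (le_max_right N _)
  obtain ⟨m, hm, hmin⟩ : ∃ m, wordNorm S (ρ.1 m) < m ∧
      ∀ k, k < m → ¬ wordNorm S (ρ.1 k) < k :=
    ⟨Nat.find hex, Nat.find_spec hex, fun k hk => Nat.find_min hex hk⟩
  have hg : ρ.1 m = g := by
    obtain ⟨N, hN⟩ := h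
    rw [← ρ.eq_of_norm_lt hS hm (le_max_left m N), hN _ (le_max_right _ _)]
  obtain ⟨k, rfl⟩ : ∃ k, m = k + 1 := ⟨m - 1, by omega⟩
  have h1 := hmin k (by omega)
  have h2 := ρ.norm_le k
  have h3 : ρ.1 (k + 1) = ρ.1 k := by
    rcases ρ.2.2 k with h | h
    · exact h
    · omega
  rw [← hg, h3] at hn
  rcases Nat.eq_or_lt_of_le (show k ≤ n by omega) with rfl | hlt
  · rw [← h3, hg]
  · rw [ρ.eq_of_norm_lt hS hm hlt, hg]

theorem EndsAt.dist_add (hS : IsFiniteGeneratingSet S) {ρ : GenRay S} {g : G} (h : ρ.EndsAt g)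
    {k : ℕ} (hk : k ≤ wordNorm S g) :
    wordNorm S (ρ.1 k) = k ∧ wordDist S (ρ.1 k) g + k = wordNorm S g := by
  have h1 := h.apply hS le_rfl
  have h2 := ρ.dist_le hS k (wordNorm S g - k)
  have h3 := ρ.norm_le k
  have h4 := (isGraphDist_wordDist hS.2).tri 1 (ρ.1 k) g
  rw [show k + (wordNorm S g - k) = wordNorm S g by omega, h1] at h2
  simp only [wordNorm] at *
  omega

theorem exists_endsAt (hS : IsFiniteGeneratingSet S) (g : G) : ∃ ρ : GenRay S, ρ.EndsAt g := by
  obtain ⟨p, p0, p1, p2⟩ := (isGraphDist_wordDist hS.2).exists_geodesic 1 g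
  refine ⟨⟨fun n => p (min n (wordDist S 1 g)), by simpa using p0, fun n => ?_⟩,
    wordDist S 1 g, fun n hn => ?_⟩
  · rcases Nat.lt_or_ge n (wordDist S 1 g) with h | h
    · right
      beta_reduce
      rw [min_eq_left (show n + 1 ≤ wordDist S 1 g by omega), min_eq_left h.le]
      have h1 := p2 0 (n + 1) (by omega) (by omega)
      have h2 := p2 n (n + 1) (by omega) (by omega)
      rw [p0] at h1
      simp only [wordNorm]
      omega
    · left
      beta_reduce
      rw [min_eq_right h, min_eq_right (show wordDist S 1 g ≤ n + 1 by omega)]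
  · simp only [min_eq_right hn, p1]

/-- The initial segment of length `n`. -/
def truncate (ρ : GenRay S) (n : ℕ) : GenRay S :=
  ⟨fun k => ρ.1 (min k n), by simpa using ρ.2.1, fun k => by
    rcases Nat.lt_or_ge k n with h | h
    · have h1 : min (k + 1) n = k + 1 := min_eq_left h
      have h2 : min k n = k := min_eq_left h.le
      beta_reduce
      rw [h1, h2]
      exact ρ.2.2 k
    · left
      have h1 : min (k + 1) n = n := min_eq_right (by omega)
      have h2 : min k n = n := min_eq_right h
      beta_reduce
      rw [h1, h2]⟩

theorem truncate_endsAt (ρ : GenRay S) (n : ℕ) : (ρ.truncate n).EndsAt (ρ.1 n) :=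
  ⟨n, fun k hk => by simp [truncate, hk]⟩

theorem tendsto_truncate (ρ : GenRay S) : Tendsto ρ.truncate atTop (𝓝 ρ) := by
  rw [tendsto_iff]
  intro k
  filter_upwards [eventually_ge_atTop k] with n hn
  simp [truncate, hn]

end GenRay

theorem GeodesicRay.norm_eq (ρ : GeodesicRay S) (n : ℕ) : wordNorm S (ρ.1 n) = n := by
  have := ρ.2.2 0 n
  rwa [ρ.2.1, zero_add] at this

/-- A geodesic ray as a generalized ray. -/
def GeodesicRay.toGen (ρ : GeodesicRay S) : GenRay S :=
  ⟨ρ.1, ρ.2.1, fun n => Or.inr ⟨ρ.norm_eq _, (ρ.2.2 n 1).le⟩⟩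

theorem GeodesicRay.isInfinite_toGen (ρ : GeodesicRay S) : ρ.toGen.IsInfinite := ρ.norm_eq

theorem GenRay.IsInfinite.exists_toGen_eq (hS : IsFiniteGeneratingSet S) {ρ : GenRay S}
    (h : ρ.IsInfinite) : ∃ σ : GeodesicRay S, σ.toGen = ρ := by
  refine ⟨⟨ρ.1, ρ.2.1, fun m k => ?_⟩, rfl⟩
  have h1 := h m
  have h2 := h (m + k)
  have h3 := ρ.dist_le hS m k
  have := (isGraphDist_wordDist hS.2).tri 1 (ρ.1 m) (ρ.1 (m + k))
  simp only [wordNorm] at *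
  omega

theorem exists_tendsto_genRay (hS : IsFiniteGeneratingSet S) {T : Type*} (u : Ultrafilter T)
    (f : T → GenRay S) : ∃ ρ, Tendsto f u (𝓝 ρ) := by
  obtain ⟨ρ, hρ⟩ := exists_pointwise_limit hS u (fun t => (f t).1) (fun t n => (f t).norm_le n)
  refine ⟨⟨ρ, ?_, fun n => ?_⟩, GenRay.tendsto_iff.2 hρ⟩
  · obtain ⟨t, ht⟩ := (hρ 0).exists
    rw [← ht, (f t).2.1]
  · obtain ⟨t, ht, ht'⟩ := ((hρ n).and (hρ (n + 1))).exists
    rw [← ht, ← ht']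
    exact (f t).2.2 n

theorem exists_tendsto_geodesicRay (hS : IsFiniteGeneratingSet S) {T : Type*} (u : Ultrafilter T)
    (f : T → GeodesicRay S) : ∃ ρ, Tendsto f u (𝓝 ρ) := by
  obtain ⟨ρ, hρ⟩ := exists_pointwise_limit hS u (fun t => (f t).1) (fun t n => ((f t).norm_eq n).le)
  refine ⟨⟨ρ, ?_, fun m k => ?_⟩, GeodesicRay.tendsto_iff.2 hρ⟩
  · obtain ⟨t, ht⟩ := (hρ 0).exists
    rw [← ht, (f t).2.1]
  · obtain ⟨t, ht, ht'⟩ := ((hρ m).and (hρ (m + k))).exists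
    rw [← ht, ← ht']
    exact (f t).2.2 m k

theorem compactSpace_geodesicRay (hS : IsFiniteGeneratingSet S) : CompactSpace (GeodesicRay S) := by
  refine ⟨isCompact_iff_ultrafilter_le_nhds.2 fun u _ => ?_⟩
  obtain ⟨ρ, hρ⟩ := exists_tendsto_geodesicRay hS u id
  exact ⟨ρ, Set.mem_univ _, hρ⟩

theorem GenRay.tendsto_toGen_iff {T : Type*} {F : Filter T} {f : T → GeodesicRay S}
    {ρ : GeodesicRay S} : Tendsto (fun t => (f t).toGen) F (𝓝 ρ.toGen) ↔ Tendsto f F (𝓝 ρ) := by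
  rw [GenRay.tendsto_iff, GeodesicRay.tendsto_iff]
  rfl

theorem FourPoint.dist_le_of_geodesic {δ : ℕ} (h4 : FourPoint (wordDist S) δ) {x y g : G}
    {k : ℕ} (hx : wordNorm S x ≤ k) (hx' : wordDist S x g + k = wordNorm S g)
    (hy : wordNorm S y ≤ k) (hy' : wordDist S y g + k = wordNorm S g) : wordDist S x y ≤ δ := by
  have h := h4 x y 1 g
  have h1 := wordDist_comm (S := S) x 1
  have h2 := wordDist_comm (S := S) y 1
  simp only [wordNorm] at *
  rcases max_cases (wordDist S x 1 + wordDist S y g) (wordDist S x g + wordDist S y 1) with h | h <;>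
  omega

theorem GenRay.dist_le_of_endsAt (hS : IsFiniteGeneratingSet S) {δ : ℕ}
    (h4 : FourPoint (wordDist S) δ) {ρ σ : GenRay S} {g : G} (hρ : ρ.EndsAt g) (hσ : σ.EndsAt g)
    (n : ℕ) : wordDist S (ρ.1 n) (σ.1 n) ≤ δ := by
  rcases le_total n (wordNorm S g) with h | h
  · obtain ⟨a, b⟩ := hρ.dist_add hS h
    obtain ⟨c, d⟩ := hσ.dist_add hS h
    exact h4.dist_le_of_geodesic a.le b c.le d
  · rw [hρ.apply hS h, hσ.apply hS h, wordDist_self]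
    omega

/-- Two four-point inequalities, with the far points taken at time `n + C`, replace the unknown
bound `C` by a uniform one. Uniformity is what makes equivalence of rays a closed relation. -/
theorem GeodesicRay.dist_le_of_equiv {δ : ℕ} (h4 : FourPoint (wordDist S) δ)
    {ρ σ : GeodesicRay S} (h : raySetoid S ρ σ) (n : ℕ) :
    wordDist S (ρ.1 n) (σ.1 n) ≤ 2 * δ := by
  obtain ⟨C, hC⟩ := h
  have h0 := hC (n + C)
  have h1 := h4 (ρ.1 n) (σ.1 (n + C)) (ρ.1 (n + C)) 1
  have h2 := h4 (ρ.1 n) (σ.1 n) (σ.1 (n + C)) 1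
  have a1 := ρ.norm_eq n
  have a2 := ρ.norm_eq (n + C)
  have a3 := σ.norm_eq n
  have a4 := σ.norm_eq (n + C)
  have a5 := ρ.2.2 n C
  have a6 := σ.2.2 n C
  simp only [wordNorm] at *
  simp only [wordDist_comm _ (1 : G), wordDist_comm (σ.1 (n + C)) (ρ.1 (n + C))] at *
  rcases max_cases (wordDist S (ρ.1 n) (ρ.1 (n + C)) + wordDist S 1 (σ.1 (n + C)))
    (wordDist S 1 (ρ.1 n) + wordDist S (ρ.1 (n + C)) (σ.1 (n + C))) with h | h <;>
  rcases max_cases (wordDist S (ρ.1 n) (σ.1 (n + C)) + wordDist S 1 (σ.1 n))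
    (wordDist S 1 (ρ.1 n) + wordDist S (σ.1 n) (σ.1 (n + C))) with h' | h' <;>
  omega

theorem tendsto_equiv {δ : ℕ} (h4 : FourPoint (wordDist S) δ) {T : Type*} {F : Filter T} [F.NeBot]
    {f g : T → GeodesicRay S} {ρ σ : GeodesicRay S} (hf : Tendsto f F (𝓝 ρ))
    (hg : Tendsto g F (𝓝 σ)) (h : ∀ᶠ t in F, raySetoid S (f t) (g t)) : raySetoid S ρ σ := by
  refine ⟨2 * δ, fun n => ?_⟩
  obtain ⟨t, h1, h2, h3⟩ := ((GeodesicRay.tendsto_iff.1 hf n).and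
    ((GeodesicRay.tendsto_iff.1 hg n).and h)).exists
  rw [← h1, ← h2]
  exact GeodesicRay.dist_le_of_equiv h4 h3 n

end Rays

/-! ### Homeomorphisms of quotients from closed relations. -/

section Correspondence

/-- The chosen maps `f` and `g` need not be continuous. On quotients they do not depend on the
choices, and the preimage of a closed set is the projection of a closed subset of `R`, hence closed
by compactness. -/
theorem homeomorph_quotient_of_correspondence {X Y : Type*} [TopologicalSpace X]
    [TopologicalSpace Y] [CompactSpace X] [CompactSpace Y] (sX : Setoid X) (sY : Setoid Y)
    (R : Set (X × Y)) (hR : IsClosed R) (h1 : ∀ x, ∃ y, (x, y) ∈ R) (h2 : ∀ y, ∃ x, (x, y) ∈ R)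
    (h : ∀ x y x' y', (x, y) ∈ R → (x', y') ∈ R → (sX x x' ↔ sY y y')) :
    Nonempty (Quotient sX ≃ₜ Quotient sY) := by
  choose f hf using h1
  choose g hg using h2
  let F : Quotient sX → Quotient sY := Quotient.map f fun a b hab => (h _ _ _ _ (hf a) (hf b)).1 hab
  let K : Quotient sY → Quotient sX := Quotient.map g fun a b hab => (h _ _ _ _ (hg a) (hg b)).2 hab
  have hF : Continuous F := by
    refine continuous_quot_lift _ ?_
    refine continuous_iff_isClosed.2 fun C hC => ?_
    convert! isClosedMap_fst_of_compactSpace _ (hR.inter ((hC.preimage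
      (continuous_quotient_mk' (s := sY))).preimage continuous_snd)) using 1
    ext x
    simp only [Set.mem_preimage, Set.mem_image, Set.mem_inter_iff, Prod.exists, exists_and_right,
      exists_eq_right]
    constructor
    · intro hx
      exact ⟨f x, hf x, hx⟩
    · rintro ⟨y, hy, hy'⟩
      have : Quotient.mk sY y = Quotient.mk sY (f x) :=
        Quotient.sound ((h _ _ _ _ hy (hf x)).1 (Setoid.refl x))
      change Quotient.mk sY (f x) ∈ C
      rw [← this]
      exact hy'
  have hK : Continuous K := by
    refine continuous_quot_lift _ ?_
    refine continuous_iff_isClosed.2 fun C hC => ?_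
    convert! isClosedMap_snd_of_compactSpace _ (hR.inter ((hC.preimage
      (continuous_quotient_mk' (s := sX))).preimage continuous_fst)) using 1
    ext x
    simp only [Set.mem_preimage, Set.mem_image, Set.mem_inter_iff, Prod.exists,
      exists_eq_right]
    constructor
    · intro hx
      exact ⟨g x, hg x, hx⟩
    · rintro ⟨y, hy, hy'⟩
      have : Quotient.mk sX y = Quotient.mk sX (g x) :=
        Quotient.sound ((h _ _ _ _ hy (hg x)).2 (Setoid.refl x))
      change Quotient.mk sX (g x) ∈ C
      rw [← this]
      exact hy'
  refine ⟨⟨⟨F, K, ?_, ?_⟩, hF, hK⟩⟩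
  · rintro ⟨x⟩
    exact Quotient.sound ((h _ _ _ _ (hg (f x)) (hf x)).2 (Setoid.refl _))
  · rintro ⟨y⟩
    exact Quotient.sound ((h _ _ _ _ (hf (g y)) (hg y)).1 (Setoid.refl _))

end Correspondence

end HypGroup

namespace HypGroup

open Filter Topology

/-! ### Invariance under isomorphism and change of generating set. -/

section ChangeOfGenerators

variable {G H : Type*} [Group G] [Group H] {S : Set G} {T : Set H}

theorem IsHyperbolicWith.of_mulEquiv (hS : IsFiniteGeneratingSet S) (hT : IsFiniteGeneratingSet T)
    (φ : G ≃* H) (h : IsHyperbolicWith S) : IsHyperbolicWith T := by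
  obtain ⟨δ, h4⟩ := h
  obtain ⟨L, hL⟩ := exists_lipschitz hS hT φ.toMonoidHom
  obtain ⟨K, hK⟩ := exists_lipschitz hT hS φ.symm.toMonoidHom
  refine FourPoint.of_biLipschitz (L := max L K) (isGraphDist_wordDist hS.2)
    (isGraphDist_wordDist hT.2) h4 (φ := φ.symm) (fun x y => ?_) (fun x y => ?_)
  · exact (hK x y).trans (Nat.mul_le_mul_right _ (le_max_right _ _))
  · have := hL (φ.symm x) (φ.symm y)
    simp only [MulEquiv.toMonoidHom_eq_coe, MonoidHom.coe_coe, MulEquiv.apply_symm_apply] at this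
    exact this.trans (Nat.mul_le_mul_right _ (le_max_left _ _))

/-- The image of `ρ` is a quasi-geodesic. The ray `σ` is a limit of geodesics from `1` to `φ (ρ N)`,
each of which follows the image by the Morse lemma. The extra `δ` accounts for the geodesic given by
the Morse lemma being possibly another one with the same ends. -/
theorem GeodesicRay.exists_near_of_mulEquiv (hS : IsFiniteGeneratingSet S)
    (hT : IsFiniteGeneratingSet T) (φ : G ≃* H) {δ : ℕ} (h4 : FourPoint (wordDist T) δ) :
    ∃ D, ∀ ρ : GeodesicRay S, ∃ σ : GeodesicRay T,
      (∀ n, ∃ m, wordDist T (φ (ρ.1 n)) (σ.1 m) ≤ D) ∧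
      ∀ m, ∃ n, wordDist T (φ (ρ.1 n)) (σ.1 m) ≤ D := by
  obtain ⟨L₁, hL₁⟩ := exists_lipschitz hS hT φ.toMonoidHom
  obtain ⟨L₂, hL₂⟩ := exists_lipschitz hT hS φ.symm.toMonoidHom
  have hd := isGraphDist_wordDist hT.2
  set L := max L₁ L₂
  have hL : ∀ x y, wordDist T (φ x) (φ y) ≤ L * wordDist S x y := fun x y =>
    (hL₁ x y).trans (Nat.mul_le_mul_right _ (le_max_left _ _))
  have hK : ∀ x y, wordDist S x y ≤ L * wordDist T (φ x) (φ y) := fun x y => by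
    have := hL₂ (φ x) (φ y)
    simp only [MulEquiv.toMonoidHom_eq_coe, MonoidHom.coe_coe, MulEquiv.symm_apply_apply] at this
    exact this.trans (Nat.mul_le_mul_right _ (le_max_right _ _))
  obtain ⟨D, hD⟩ := h4.morse hd L
  refine ⟨D + δ, fun ρ => ?_⟩
  have hpath : ∀ N, IsLipPath (wordDist T) L (fun i => φ (ρ.1 i)) N := fun N =>
    IsLipPath.of_geodesic hL hK (fun i j hij _ => by
      have := ρ.2.2 i (j - i)
      rw [show i + (j - i) = j by omega] at this
      omega)
  have hfar : ∀ N, N ≤ L * wordNorm T (φ (ρ.1 N)) := fun N => by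
    have h1 := hK 1 (ρ.1 N)
    have h2 := ρ.norm_eq N
    simp only [wordNorm, map_one] at *
    omega
  have hfar' : ∀ k, ∀ᶠ N in (hyperfilter ℕ : Filter ℕ), k ≤ wordNorm T (φ (ρ.1 N)) := by
    intro k
    filter_upwards [Nat.hyperfilter_le_atTop (eventually_ge_atTop (L * k + 1))] with N hN
    by_contra! hc
    have := hfar N
    have := Nat.mul_le_mul_left L hc.le
    omega
  choose γ hγ using fun N => GenRay.exists_endsAt hT (φ (ρ.1 N))
  obtain ⟨σ', hσ'⟩ := exists_tendsto_genRay hT (hyperfilter ℕ) γ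
  have hlim := GenRay.tendsto_iff.1 hσ'
  have hinf : σ'.IsInfinite := by
    intro k
    obtain ⟨N, h1, h2⟩ := ((hlim k).and (hfar' k)).exists
    rw [← h1]
    exact ((hγ N).dist_add hT h2).1
  obtain ⟨σ, rfl⟩ := hinf.exists_toGen_eq hT
  refine ⟨σ, fun n => ?_, fun m => ?_⟩
  · have hall : ∀ᶠ N in (hyperfilter ℕ : Filter ℕ), ∀ m ∈ Set.Iic (wordNorm T (φ (ρ.1 n)) + D),
        (γ N).1 m = σ.1 m :=
      (eventually_all_finite (Set.finite_Iic _)).2 fun m _ => hlim m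
    have hge : ∀ᶠ N in (hyperfilter ℕ : Filter ℕ), n ≤ N :=
      Nat.hyperfilter_le_atTop (eventually_ge_atTop n)
    obtain ⟨N, h1, h2⟩ := (hall.and hge).exists
    obtain ⟨w, hw, hwD⟩ := (hD N _ (hpath N)).2 n h2
    simp only [ρ.2.1, map_one, Between, Set.mem_ofPred_eq] at hw
    have h3 := hd.tri 1 (φ (ρ.1 n)) w
    have h5 := hd.comm w (φ (ρ.1 n))
    have h6 := h1 (wordNorm T w) (by simp only [Set.mem_Iic, wordNorm]; omega)
    obtain ⟨h7, h8⟩ := (hγ N).dist_add hT (k := wordNorm T w) (by simp only [wordNorm]; omega)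
    have h9 := h4.dist_le_of_geodesic (x := w) (y := (γ N).1 (wordNorm T w)) le_rfl
      (by simp only [wordNorm]; omega) h7.le h8
    have := hd.tri (φ (ρ.1 n)) w (σ.1 (wordNorm T w))
    rw [h6] at h9
    exact ⟨wordNorm T w, by omega⟩
  · obtain ⟨N, h1, h2⟩ := ((hlim m).and (hfar' m)).exists
    obtain ⟨h3, h4⟩ := (hγ N).dist_add hT h2
    obtain ⟨k, -, hk⟩ := (hD N _ (hpath N)).1 ((γ N).1 m) (by
      simp only [ρ.2.1, map_one, Between, Set.mem_ofPred_eq]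
      simp only [wordNorm] at h3 h4
      omega)
    refine ⟨k, ?_⟩
    rw [h1, wordDist_comm] at hk
    change wordDist T (φ (ρ.1 k)) (σ.1 m) ≤ D at hk
    omega

/-- The times `n` and `m` are the distances to the identity, so they differ by at most `E`. -/
theorem GeodesicRay.equiv_of_near (hS : IsFiniteGeneratingSet S) {ρ σ : GeodesicRay S} {E : ℕ}
    (h : ∀ n, ∃ m, wordDist S (ρ.1 n) (σ.1 m) ≤ E) : raySetoid S ρ σ := by
  refine ⟨2 * E, fun n => ?_⟩
  obtain ⟨m, hm⟩ := h n
  have hd := isGraphDist_wordDist hS.2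
  have h1 := ρ.norm_eq n
  have h2 := σ.norm_eq m
  have h3 := hd.tri 1 (ρ.1 n) (σ.1 m)
  have h4 := hd.tri 1 (σ.1 m) (ρ.1 n)
  have h5 := hd.comm (ρ.1 n) (σ.1 m)
  have h6 := hd.tri (ρ.1 n) (σ.1 m) (σ.1 n)
  have h7 : wordDist S (σ.1 m) (σ.1 n) ≤ E := by
    simp only [wordNorm] at h1 h2
    rcases le_total m n with h | h
    · have := σ.2.2 m (n - m)
      rw [show m + (n - m) = n by omega] at this
      omega
    · have := σ.2.2 n (m - n)
      rw [show n + (m - n) = m by omega, wordDist_comm] at this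
      omega
  omega

theorem homeomorph_gromovBoundary_of_mulEquiv (hS : IsFiniteGeneratingSet S)
    (hT : IsFiniteGeneratingSet T) (φ : G ≃* H) (h : IsHyperbolicWith S) :
    Nonempty (GromovBoundary S ≃ₜ GromovBoundary T) := by
  have hT4 := h.of_mulEquiv hS hT φ
  obtain ⟨δ, hδ⟩ := h
  obtain ⟨ε, hε⟩ := hT4
  obtain ⟨L, hL⟩ := exists_lipschitz hS hT φ.toMonoidHom
  obtain ⟨K, hK'⟩ := exists_lipschitz hT hS φ.symm.toMonoidHom
  have hK : ∀ x y, wordDist S x y ≤ K * wordDist T (φ x) (φ y) := fun x y => by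
    simpa using hK' (φ x) (φ y)
  simp only [MulEquiv.toMonoidHom_eq_coe, MonoidHom.coe_coe] at hL hK'
  obtain ⟨D₁, hD₁⟩ := GeodesicRay.exists_near_of_mulEquiv hS hT φ hε
  obtain ⟨D₂, hD₂⟩ := GeodesicRay.exists_near_of_mulEquiv hT hS φ.symm hδ
  have := compactSpace_geodesicRay hS
  have := compactSpace_geodesicRay hT
  have hd := isGraphDist_wordDist hT.2
  have hd' := isGraphDist_wordDist hS.2
  -- The relation is Hausdorff distance at most `D` in `T`; the term `L * D₂` covers the pairs
  -- produced by `φ.symm`.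
  set D := D₁ + L * D₂ with hD
  refine homeomorph_quotient_of_correspondence (raySetoid S) (raySetoid T)
    {p | (∀ n, ∃ m, wordDist T (φ (p.1.1 n)) (p.2.1 m) ≤ D) ∧
      ∀ m, ∃ n, wordDist T (φ (p.1.1 n)) (p.2.1 m) ≤ D} ?_ ?_ ?_ ?_
  · refine isClosed_iff_ultrafilter.2 ?_
    rintro ⟨ρ, σ⟩ u hu hmem
    have h1 := GeodesicRay.tendsto_iff.1 ((continuous_fst.tendsto (ρ, σ)).comp
      (tendsto_id'.2 hu))
    have h2 := GeodesicRay.tendsto_iff.1 ((continuous_snd.tendsto (ρ, σ)).comp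
      (tendsto_id'.2 hu))
    simp only [Function.comp, id] at h1 h2
    refine ⟨fun n => ?_, fun m => ?_⟩
    -- The time `m` of the partner point is bounded in terms of `n`, so finitely many coordinates
    -- have to be stabilised; hence the existential condition is closed.
    · have hall : ∀ᶠ p in (u : Filter (GeodesicRay S × GeodesicRay T)),
          ∀ m ∈ Set.Iic (wordNorm T (φ (ρ.1 n)) + D), p.2.1 m = σ.1 m :=
        (eventually_all_finite (Set.finite_Iic _)).2 fun m _ => h2 m
      obtain ⟨p, a1, a2, a3⟩ := ((h1 n).and (hall.and hmem)).exists
      obtain ⟨m, hm⟩ := a3.1 n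
      rw [a1] at hm
      have b1 := hd.tri 1 (φ (ρ.1 n)) (p.2.1 m)
      have b2 := p.2.norm_eq m
      simp only [wordNorm] at b2
      rw [a2 m (by simp only [Set.mem_Iic, wordNorm]; omega)] at hm
      exact ⟨m, hm⟩
    · have hall : ∀ᶠ p in (u : Filter (GeodesicRay S × GeodesicRay T)),
          ∀ n ∈ Set.Iic (K * (m + D)), p.1.1 n = ρ.1 n :=
        (eventually_all_finite (Set.finite_Iic _)).2 fun m _ => h1 m
      obtain ⟨p, a1, a2, a3⟩ := ((h2 m).and (hall.and hmem)).exists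
      obtain ⟨n, hn⟩ := a3.2 m
      have b1 := hd.tri 1 (p.2.1 m) (φ (p.1.1 n))
      have b2 := p.2.norm_eq m
      have b3 := p.1.norm_eq n
      have b4 := hK 1 (p.1.1 n)
      have b5 := hd.comm (p.2.1 m) (φ (p.1.1 n))
      rw [map_one] at b4
      simp only [wordNorm] at b2 b3
      have b6 := Nat.mul_le_mul_left K (show wordDist T 1 (φ (p.1.1 n)) ≤ m + D by omega)
      rw [a1, a2 n (by simp only [Set.mem_Iic]; omega)] at hn
      exact ⟨n, hn⟩
  · intro ρ
    obtain ⟨σ, h1, h2⟩ := hD₁ ρ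
    exact ⟨σ, fun n => (h1 n).imp fun m hm => hm.trans (by omega),
      fun n => (h2 n).imp fun m hm => hm.trans (by omega)⟩
  · intro σ
    obtain ⟨ρ, h1, h2⟩ := hD₂ σ
    have key : ∀ n m, wordDist S (φ.symm (σ.1 m)) (ρ.1 n) ≤ D₂ →
        wordDist T (φ (ρ.1 n)) (σ.1 m) ≤ D := by
      intro n m hnm
      have h3 := hL (φ.symm (σ.1 m)) (ρ.1 n)
      rw [φ.apply_symm_apply, wordDist_comm] at h3
      have h4 := Nat.mul_le_mul_left L hnm
      omega
    exact ⟨ρ, fun n => (h2 n).imp fun m hm => key _ _ hm,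
      fun n => (h1 n).imp fun m hm => key _ _ hm⟩
  · rintro ρ σ ρ' σ' ⟨h1, h2⟩ ⟨h3, h4⟩
    constructor
    · rintro ⟨C, hC⟩
      refine GeodesicRay.equiv_of_near hT (E := D + L * C + D) fun m => ?_
      obtain ⟨n, hn⟩ := h2 m
      obtain ⟨m', hm'⟩ := h3 n
      refine ⟨m', ?_⟩
      have a1 := hL (ρ.1 n) (ρ'.1 n)
      have a2 := Nat.mul_le_mul_left L (hC n)
      have a3 := hd.tri (σ.1 m) (φ (ρ.1 n)) (σ'.1 m')
      have a4 := hd.tri (φ (ρ.1 n)) (φ (ρ'.1 n)) (σ'.1 m')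
      have a5 := hd.comm (σ.1 m) (φ (ρ.1 n))
      dsimp only at hn hm'
      omega
    · rintro ⟨C, hC⟩
      refine GeodesicRay.equiv_of_near hS (E := K * (D + C + D)) fun n => ?_
      obtain ⟨m, hm⟩ := h1 n
      obtain ⟨n', hn'⟩ := h4 m
      refine ⟨n', (hK _ _).trans (Nat.mul_le_mul_left _ ?_)⟩
      have a2 := hC m
      have a3 := hd.tri (φ (ρ.1 n)) (σ.1 m) (φ (ρ'.1 n'))
      have a4 := hd.tri (σ.1 m) (σ'.1 m) (φ (ρ'.1 n'))
      have a5 := hd.comm (σ'.1 m) (φ (ρ'.1 n'))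
      dsimp only at hm hn'
      omega

end ChangeOfGenerators

end HypGroup

/-! ### Hausdorff boundaries and shadows of group elements. -/

namespace HypGroup

open Filter Topology

/-- Saturations of closed sets are projections of closed sets, so the quotient map is closed; two
classes are disjoint compact sets and can be separated upstairs. -/
theorem t2Space_quotient_of_isClosed {X : Type*} [TopologicalSpace X] [CompactSpace X]
    [T2Space X] (s : Setoid X) (h : IsClosed {p : X × X | s p.1 p.2}) : T2Space (Quotient s) := by
  have hclosed : IsClosedMap (Quotient.mk s) := by
    intro C hC
    rw [← (isQuotientMap_quotient_mk' (s := s)).isClosed_preimage]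
    convert! isClosedMap_snd_of_compactSpace _ (h.inter (hC.preimage continuous_fst)) using 1
    ext x
    simp only [Set.mem_preimage, Set.mem_image, Set.mem_inter_iff, Prod.exists, exists_eq_right,
      Set.mem_ofPred_eq]
    constructor
    · rintro ⟨y, hy, hyx⟩
      exact ⟨y, Quotient.exact hyx, hy⟩
    · rintro ⟨y, hy, hyx⟩
      exact ⟨y, hyx, Quotient.sound hy⟩
  refine ⟨fun a b => ?_⟩
  induction a using Quotient.inductionOn with | _ x => ?_
  induction b using Quotient.inductionOn with | _ y => ?_
  intro hxy
  have hc : ∀ x, IsClosed {z | s x z} := fun x => h.preimage (f := fun z => (x, z)) (by fun_prop)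
  obtain ⟨U, V, hU, hV, hxU, hyV, hUV⟩ := SeparatedNhds.of_isCompact_isCompact
    (hc x).isCompact (hc y).isCompact (Set.disjoint_left.2 fun z hz hz' =>
      hxy (Quotient.sound (s.trans' hz (s.symm' hz'))))
  refine ⟨(Quotient.mk s '' Uᶜ)ᶜ, (Quotient.mk s '' Vᶜ)ᶜ, (hclosed _ hU.isClosed_compl).isOpen_compl,
    (hclosed _ hV.isClosed_compl).isOpen_compl, ?_, ?_, ?_⟩
  · rintro ⟨z, hz, hzx⟩
    exact hz (hxU (s.symm' (Quotient.exact hzx)))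
  · rintro ⟨z, hz, hzx⟩
    exact hz (hyV (s.symm' (Quotient.exact hzx)))
  · rw [Set.disjoint_left]
    intro c
    induction c using Quotient.inductionOn with | _ z => ?_
    intro h1 h2
    have h1' : z ∈ U := by by_contra hc; exact h1 ⟨z, hc, rfl⟩
    have h2' : z ∈ V := by by_contra hc; exact h2 ⟨z, hc, rfl⟩
    exact Set.disjoint_left.1 hUV h1' h2'

/-- Hall's condition holds once the set with number `n` is cut down to `n + 1` elements: the member
of `s` with the largest number already supplies enough values. -/
theorem exists_injective_mem_of_infinite {ι β : Type*} [Countable ι] (T : ι → Set β)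
    (hT : ∀ i, (T i).Infinite) : ∃ f : ι → β, Function.Injective f ∧ ∀ i, f i ∈ T i := by
  classical
  obtain ⟨e, he⟩ := exists_injective_nat ι
  choose t ht htc using fun i => (hT i).exists_subset_card_eq (e i + 1)
  have hall := (Finset.all_card_le_biUnion_card_iff_exists_injective t).1 fun s => by
    rcases s.eq_empty_or_nonempty with rfl | hs
    · simp
    · obtain ⟨i, hi, hmax⟩ := s.exists_max_image e hs
      calc s.card = (s.image e).card := (Finset.card_image_of_injective _ he).symm
        _ ≤ (Finset.range (e i + 1)).card := Finset.card_le_card fun n hn => by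
            obtain ⟨j, hj, rfl⟩ := Finset.mem_image.1 hn
            exact Finset.mem_range.2 (Nat.lt_succ_of_le (hmax j hj))
        _ = (t i).card := by rw [htc, Finset.card_range]
        _ ≤ (s.biUnion t).card := Finset.card_le_card (Finset.subset_biUnion_of_mem t hi)
  obtain ⟨f, hf, hft⟩ := hall
  exact ⟨f, hf, fun i => ht i (hft i)⟩

section Boundary

variable {G : Type*} [Group G] {S : Set G}

theorem t2Space_geodesicRay : T2Space (GeodesicRay S) := by
  refine t2_iff_ultrafilter.2 fun {ρ σ} u h1 h2 => Subtype.ext (funext fun n => ?_)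
  obtain ⟨τ, a, b⟩ := ((GeodesicRay.tendsto_iff.1 (tendsto_id'.2 h1) n).and
    (GeodesicRay.tendsto_iff.1 (tendsto_id'.2 h2) n)).exists
  exact a.symm.trans b

theorem t2Space_gromovBoundary (hS : IsFiniteGeneratingSet S) (h : IsHyperbolicWith S) :
    T2Space (GromovBoundary S) := by
  obtain ⟨δ, h4⟩ := h
  have := compactSpace_geodesicRay hS
  have := t2Space_geodesicRay (S := S)
  refine t2Space_quotient_of_isClosed (raySetoid S) (isClosed_iff_ultrafilter.2 ?_)
  rintro ⟨ρ, σ⟩ u hu hmem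
  exact tendsto_equiv (δ := δ) h4 ((continuous_fst.tendsto (ρ, σ)).comp (tendsto_id'.2 hu))
    ((continuous_snd.tendsto (ρ, σ)).comp (tendsto_id'.2 hu)) hmem

theorem countable_of_isFiniteGeneratingSet (hS : IsFiniteGeneratingSet S) : Countable G := by
  have : (⋃ n : ℕ, {g : G | wordNorm S g ≤ n}) = Set.univ :=
    Set.eq_univ_of_forall fun g => Set.mem_iUnion.2 ⟨wordNorm S g, le_refl (wordNorm S g)⟩
  exact Set.countable_univ_iff.1
    (this ▸ Set.countable_iUnion fun n => (finite_wordNorm_le hS n).countable)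

theorem nonempty_geodesicRay (hS : IsFiniteGeneratingSet S) [Infinite G] :
    Nonempty (GeodesicRay S) := by
  have : ∀ n : ℕ, ∃ g, n ≤ wordNorm S g := by
    intro n
    by_contra! hc
    exact Set.infinite_univ ((finite_wordNorm_le hS n).subset fun g _ => (hc g).le)
  choose g hg using this
  choose γ hγ using fun n => GenRay.exists_endsAt hS (g n)
  obtain ⟨σ, hσ⟩ := exists_tendsto_genRay hS (hyperfilter ℕ) γ
  have : σ.IsInfinite := by
    intro k
    obtain ⟨n, h1, h2⟩ := ((GenRay.tendsto_iff.1 hσ k).and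
      (Nat.hyperfilter_le_atTop (eventually_ge_atTop k))).exists
    rw [← h1]
    exact ((hγ n).dist_add hS (h2.trans (hg n))).1
  obtain ⟨τ, -⟩ := this.exists_toGen_eq hS
  exact ⟨τ⟩

/-- The class of a ray in the boundary. -/
def GeodesicRay.toBoundary (ρ : GeodesicRay S) : GromovBoundary S := Quotient.mk (raySetoid S) ρ

theorem GeodesicRay.continuous_toBoundary :
    Continuous (GeodesicRay.toBoundary : GeodesicRay S → GromovBoundary S) :=
  continuous_quotient_mk' (s := raySetoid S)

theorem GeodesicRay.toBoundary_eq_iff {ρ σ : GeodesicRay S} :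
    ρ.toBoundary = σ.toBoundary ↔ raySetoid S ρ σ := Quotient.eq (r := raySetoid S)

theorem GeodesicRay.exists_toBoundary_eq (ξ : GromovBoundary S) :
    ∃ ρ : GeodesicRay S, ρ.toBoundary = ξ := Quotient.exists_rep (s := raySetoid S) ξ

/-- The ray `ρ` follows a geodesic from the identity to `g` as long as any ray does. -/
def IsShadow (ρ : GeodesicRay S) (g : G) : Prop :=
  ∀ (σ : GeodesicRay S) (k : ℕ), wordDist S (σ.1 k) g + k = wordNorm S g →
    wordDist S (ρ.1 k) g + k = wordNorm S g

theorem exists_isShadow (hS : IsFiniteGeneratingSet S) [Infinite G] (g : G) :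
    ∃ ρ : GeodesicRay S, IsShadow ρ g := by
  classical
  obtain ⟨ρ₀⟩ := nonempty_geodesicRay hS
  set P : ℕ → Prop := fun k => ∃ ρ : GeodesicRay S, wordDist S (ρ.1 k) g + k = wordNorm S g with hP
  obtain ⟨ρ, hρ⟩ : P (Nat.findGreatest P (wordNorm S g)) :=
    Nat.findGreatest_spec (P := P) (m := 0) (by omega) ⟨ρ₀, by rw [ρ₀.2.1]; rfl⟩
  refine ⟨ρ, fun σ k hk => ?_⟩
  have h1 : k ≤ Nat.findGreatest P (wordNorm S g) := Nat.le_findGreatest (by omega) ⟨σ, hk⟩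
  have h2 := ρ.2.2 k (Nat.findGreatest P (wordNorm S g) - k)
  rw [show k + (Nat.findGreatest P (wordNorm S g) - k) = Nat.findGreatest P (wordNorm S g)
    by omega] at h2
  have hd := isGraphDist_wordDist hS.2
  have h3 := hd.tri (ρ.1 k) (ρ.1 (Nat.findGreatest P (wordNorm S g))) g
  have h4 := hd.tri 1 (ρ.1 k) g
  have h5 := ρ.norm_eq k
  simp only [wordNorm] at *
  omega

theorem IsShadow.apply_eq (hS : IsFiniteGeneratingSet S) {ρ σ : GeodesicRay S} {n : ℕ}
    (h : IsShadow ρ (σ.1 n)) : ρ.1 n = σ.1 n := by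
  have := h σ n (by rw [wordDist_self, σ.norm_eq]; omega)
  rw [σ.norm_eq] at this
  exact (isGraphDist_wordDist hS.2).eq_of _ _ (by omega)

theorem GenRay.eventually_dist_add (hS : IsFiniteGeneratingSet S) {T : Type*} {F : Filter T}
    {γ : T → GenRay S} {σ : GeodesicRay S} (hγ : Tendsto γ F (𝓝 σ.toGen)) {g : T → G}
    (hg : ∀ᶠ t in F, (γ t).EndsAt (g t)) (k : ℕ) :
    ∀ᶠ t in F, k ≤ wordNorm S (g t) ∧ wordDist S (σ.1 k) (g t) + k = wordNorm S (g t) := by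
  filter_upwards [hg, GenRay.tendsto_iff.1 hγ k] with t h1 h2
  have h3 : k ≤ wordNorm S (g t) := by
    by_contra! hc
    rw [h1.apply hS hc.le] at h2
    have := σ.norm_eq k
    rw [h2] at hc
    change wordNorm S (σ.1 k) < k at hc
    omega
  have h4 := (h1.dist_add hS h3).2
  rw [h2] at h4
  exact ⟨h3, h4⟩

/-- For fixed `k`, the point `σ k` eventually lies on a geodesic to `g t`. The shadow then also
follows a geodesic to `g t` up to time `k`, so it is `δ`-close to `σ` there. -/
theorem tendsto_toBoundary_of_isShadow (hS : IsFiniteGeneratingSet S) (h : IsHyperbolicWith S)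
    {T : Type*} {u : Ultrafilter T}
    {γ : T → GenRay S} {σ : GeodesicRay S} (hγ : Tendsto γ u (𝓝 σ.toGen)) {g : T → G}
    (hg : ∀ᶠ t in u, (γ t).EndsAt (g t)) {r : T → GeodesicRay S}
    (hr : ∀ t, IsShadow (r t) (g t)) :
    Tendsto (fun t => (r t).toBoundary) u (𝓝 σ.toBoundary) := by
  obtain ⟨δ, h4⟩ := h
  obtain ⟨τ, hτ⟩ := exists_tendsto_geodesicRay hS u r
  have : τ.toBoundary = σ.toBoundary := by
    refine GeodesicRay.toBoundary_eq_iff.2 ⟨δ, fun k => ?_⟩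
    obtain ⟨t, ⟨-, h1⟩, h2⟩ := ((GenRay.eventually_dist_add hS hγ hg k).and
      (GeodesicRay.tendsto_iff.1 hτ k)).exists
    have h3 := hr t σ k h1
    rw [h2] at h3
    exact FourPoint.dist_le_of_geodesic (δ := δ) h4 (τ.norm_eq k).le h3 (σ.norm_eq k).le h1
  rw [← this]
  exact (GeodesicRay.continuous_toBoundary.tendsto τ).comp hτ

/-- The boundary points are represented by rays which meet at a time `≥ n`. -/
def MeetBeyond (n : ℕ) (ξ η : GromovBoundary S) : Prop :=
  ∃ p : GeodesicRay S × GeodesicRay S, p.1.toBoundary = ξ ∧ p.2.toBoundary = η ∧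
    ∃ m, n ≤ m ∧ p.1.1 m = p.2.1 m

/-- Rays that meet at time `m` are `δ`-close up to time `m`. As the meeting times tend to infinity,
limits of the representatives are `δ`-close forever. -/
theorem eq_of_tendsto_of_meetBeyond (hS : IsFiniteGeneratingSet S) (h : IsHyperbolicWith S)
    {T : Type*} {u : Ultrafilter T} {ξ η : T → GromovBoundary S} {ξ₀ η₀ : GromovBoundary S}
    (hξ : Tendsto ξ u (𝓝 ξ₀)) (hη : Tendsto η u (𝓝 η₀)) {n : T → ℕ}
    (hn : ∀ k, ∀ᶠ t in u, k ≤ n t) (hm : ∀ᶠ t in u, MeetBeyond (n t) (ξ t) (η t)) : ξ₀ = η₀ := by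
  have := t2Space_gromovBoundary hS h
  obtain ⟨δ, h4⟩ := h
  have : Nonempty (GeodesicRay S × GeodesicRay S) := by
    obtain ⟨t, p, -⟩ := hm.exists
    exact ⟨p⟩
  obtain ⟨p, hp⟩ := hm.choice
  obtain ⟨σ, hσ⟩ := exists_tendsto_geodesicRay hS u fun t => (p t).1
  obtain ⟨τ, hτ⟩ := exists_tendsto_geodesicRay hS u fun t => (p t).2
  have e1 : σ.toBoundary = ξ₀ := tendsto_nhds_unique_of_eventuallyEq
    ((GeodesicRay.continuous_toBoundary.tendsto σ).comp hσ) hξ (hp.mono fun t ht => ht.1)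
  have e2 : τ.toBoundary = η₀ := tendsto_nhds_unique_of_eventuallyEq
    ((GeodesicRay.continuous_toBoundary.tendsto τ).comp hτ) hη (hp.mono fun t ht => ht.2.1)
  rw [← e1, ← e2]
  refine GeodesicRay.toBoundary_eq_iff.2 ⟨δ, fun k => ?_⟩
  obtain ⟨t, ⟨-, -, m, h1, h2⟩, h3, h5, h6⟩ := (hp.and ((hn k).and
    ((GeodesicRay.tendsto_iff.1 hσ k).and (GeodesicRay.tendsto_iff.1 hτ k)))).exists
  rw [← h5, ← h6]
  have a1 := (p t).1.2.2 k (m - k)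
  have a2 := (p t).2.2.2 k (m - k)
  rw [show k + (m - k) = m by omega] at a1 a2
  have a3 := (p t).1.norm_eq m
  rw [← h2] at a2
  exact FourPoint.dist_le_of_geodesic (δ := δ) (g := (p t).1.1 m) h4 (((p t).1.norm_eq k).le)
    (by omega) (((p t).2.norm_eq k).le) (by omega)

/-- The points of a ray towards `ξ` suffice: the shadow of such a point passes through it. -/
theorem infinite_setOf_meetBeyond (hS : IsFiniteGeneratingSet S) {r : G → GeodesicRay S}
    (hr : ∀ g, IsShadow (r g) g) (ξ : GromovBoundary S) (n : ℕ) :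
    {g : {g : G // g ≠ 1} | MeetBeyond n (r g).toBoundary ξ}.Infinite := by
  obtain ⟨ρ, rfl⟩ := GeodesicRay.exists_toBoundary_eq ξ
  refine Set.infinite_of_injective_forall_mem
    (f := fun k : ℕ => (⟨ρ.1 (n + 1 + k), fun h => ?_⟩ : {g : G // g ≠ 1})) ?_ fun k => ?_
  · have := ρ.norm_eq (n + 1 + k)
    rw [h, wordNorm_one] at this
    omega
  · intro k l hkl
    have h1 := ρ.norm_eq (n + 1 + k)
    have h2 := ρ.norm_eq (n + 1 + l)
    simp only [Subtype.mk.injEq] at hkl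
    rw [hkl] at h1
    omega
  · exact ⟨(r _, ρ), rfl, rfl, n + 1 + k, by omega, (hr _).apply_eq hS⟩

end Boundary

/-! ### Extending a boundary homeomorphism to a bijection of the groups. -/

section Matching

variable {G H : Type*} [Group G] [Group H] {S : Set G} {T : Set H}

/-- The correspondence between generalized rays induced by a bijection of the groups and a bijection
of the boundaries. -/
def rayCorrespondence (α : G ≃ H) (f : GromovBoundary S ≃ₜ GromovBoundary T) :
    Set (GenRay S × GenRay T) :=
  {p | (∃ g, p.1.EndsAt g ∧ p.2.EndsAt (α g)) ∨
    ∃ q : GeodesicRay S × GeodesicRay T, q.1.toGen = p.1 ∧ q.2.toGen = p.2 ∧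
      f q.1.toBoundary = q.2.toBoundary}

theorem GenRay.endsAt_of_apply_eq (hS : IsFiniteGeneratingSet S) {ρ : GenRay S} {n : ℕ} {g : G}
    (h : ρ.1 n = g) (hn : wordNorm S g < n) : ρ.EndsAt g :=
  ⟨n, fun m hm => by rw [ρ.eq_of_norm_lt hS (by rwa [h]) hm, h]⟩

theorem GenRay.EndsAt.eventually (hS : IsFiniteGeneratingSet S) {ι : Type*} {F : Filter ι}
    {γ : ι → GenRay S} {ρ : GenRay S} (hγ : Tendsto γ F (𝓝 ρ)) {g : G} (hg : ρ.EndsAt g) :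
    ∀ᶠ t in F, (γ t).EndsAt g := by
  filter_upwards [GenRay.tendsto_iff.1 hγ (wordNorm S g + 1)] with t ht
  rw [hg.apply hS (by omega)] at ht
  exact GenRay.endsAt_of_apply_eq hS ht (by omega)

theorem GenRay.EndsAt.of_tendsto (hS : IsFiniteGeneratingSet S) {ι : Type*} {F : Filter ι}
    [F.NeBot] {γ : ι → GenRay S} {ρ : GenRay S} (hγ : Tendsto γ F (𝓝 ρ)) {g : G}
    (hg : ∀ᶠ t in F, (γ t).EndsAt g) : ρ.EndsAt g := by
  refine ⟨wordNorm S g, fun n hn => ?_⟩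
  obtain ⟨t, h1, h2⟩ := ((GenRay.tendsto_iff.1 hγ n).and hg).exists
  rw [← h1, h2.apply hS hn]

/-- Closedness expresses that `α` and `f` together form a homeomorphism of the compactifications.
Each nontrivial `g` is matched with an element whose shadow meets `f` of the shadow of `g` beyond a
norm that tends to infinity. The identity is set aside so that syllables stay nontrivial under `α`.
-/
theorem exists_equiv_isClosed_rayCorrespondence [Infinite G] [Infinite H]
    (hS : IsFiniteGeneratingSet S) (hT : IsFiniteGeneratingSet T) (hS' : IsHyperbolicWith S)
    (hT' : IsHyperbolicWith T) (f : GromovBoundary S ≃ₜ GromovBoundary T) :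
    ∃ α : G ≃ H, α 1 = 1 ∧ IsClosed (rayCorrespondence α f) := by
  classical
  choose r hr using exists_isShadow hS
  choose s hs using exists_isShadow hT
  have := countable_of_isFiniteGeneratingSet hS
  have := countable_of_isFiniteGeneratingSet hT
  obtain ⟨i, hi, hi'⟩ := exists_injective_mem_of_infinite
    (fun g : {g : G // g ≠ 1} => {h : {h : H // h ≠ 1} |
      MeetBeyond (wordNorm S g.1) (s h).toBoundary (f (r g).toBoundary)})
    fun g => infinite_setOf_meetBeyond hT hs _ _
  obtain ⟨j, hj, hj'⟩ := exists_injective_mem_of_infinite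
    (fun h : {h : H // h ≠ 1} => {g : {g : G // g ≠ 1} |
      MeetBeyond (wordNorm T h.1) (r g).toBoundary (f.symm (s h).toBoundary)})
    fun h => infinite_setOf_meetBeyond hS hr _ _
  -- The bijection takes each of its values from `i` or from an inverse of `j`, so each matched pair
  -- satisfies one of the two meeting conditions.
  obtain ⟨m, hm, hm'⟩ := Function.Embedding.schroeder_bernstein_of_rel hi hj
    (fun g h => MeetBeyond (wordNorm S g.1) (s h).toBoundary (f (r g).toBoundary) ∨
      MeetBeyond (wordNorm T h.1) (r g).toBoundary (f.symm (s h).toBoundary))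
    (fun g => Or.inl (hi' g)) (fun h => Or.inr (hj' h))
  let e := Equiv.ofBijective m hm
  let e₁ : {g : G // ¬ g ≠ 1} ≃ {h : H // ¬ h ≠ 1} :=
    ⟨fun _ => ⟨1, not_not.2 rfl⟩, fun _ => ⟨1, not_not.2 rfl⟩,
      fun x => Subtype.ext (not_not.1 x.2).symm, fun x => Subtype.ext (not_not.1 x.2).symm⟩
  let α : G ≃ H := (Equiv.sumCompl fun g : G => g ≠ 1).symm.trans
    ((Equiv.sumCongr e e₁).trans
      (Equiv.sumCompl fun h : H => h ≠ 1))
  have hα1 : α 1 = 1 := by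
    simp [α, e₁, Equiv.sumCompl_symm_apply_of_neg]
  have hαm : ∀ g (hg : g ≠ 1), α g = m ⟨g, hg⟩ := by
    intro g hg
    simp [α, Equiv.sumCompl_symm_apply_of_pos, hg, e]
  have hα : ∀ g, g ≠ 1 → MeetBeyond (wordNorm S g) (s (α g)).toBoundary (f (r g).toBoundary) ∨
      MeetBeyond (wordNorm T (α g)) (r g).toBoundary (f.symm (s (α g)).toBoundary) := by
    intro g hg
    rw [hαm g hg]
    exact hm' ⟨g, hg⟩
  refine ⟨α, hα1, isClosed_iff_ultrafilter.2 ?_⟩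
  rintro ⟨γ, γ'⟩ u hu hmem
  have l1 : Tendsto (fun p : GenRay S × GenRay T => p.1) u (𝓝 γ) :=
    (continuous_fst.tendsto (γ, γ')).comp (tendsto_id'.2 hu)
  have l2 : Tendsto (fun p : GenRay S × GenRay T => p.2) u (𝓝 γ') :=
    (continuous_snd.tendsto (γ, γ')).comp (tendsto_id'.2 hu)
  have hmem' : ∀ᶠ p in (u : Filter (GenRay S × GenRay T)), p ∈ rayCorrespondence α f := hmem
  have end1 : ∀ g, γ.EndsAt g → γ'.EndsAt (α g) := by
    intro g hg
    refine GenRay.EndsAt.of_tendsto hT l2 ?_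
    filter_upwards [hmem', GenRay.EndsAt.eventually hS l1 hg] with p hp hp'
    rcases hp with ⟨g', h1, h2⟩ | ⟨q, h1, -⟩
    · rwa [hp'.unique h1]
    · exact absurd (h1 ▸ q.1.isInfinite_toGen) hp'.not_isInfinite
  have end2 : ∀ h, γ'.EndsAt h → γ.EndsAt (α.symm h) := by
    intro h hh
    refine GenRay.EndsAt.of_tendsto hS l1 ?_
    filter_upwards [hmem', GenRay.EndsAt.eventually hT l2 hh] with p hp hp'
    rcases hp with ⟨g', h1, h2⟩ | ⟨q, -, h1, -⟩
    · rwa [hp'.unique h2, α.symm_apply_apply]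
    · exact absurd (h1 ▸ q.2.isInfinite_toGen) hp'.not_isInfinite
  rcases γ.isInfinite_or_endsAt hS with hγ | ⟨g, hg⟩
  swap
  · exact Or.inl ⟨g, hg, end1 g hg⟩
  rcases γ'.isInfinite_or_endsAt hT with hγ' | ⟨h, hh⟩
  swap
  · exact absurd hγ (end2 h hh).not_isInfinite
  obtain ⟨ρ, rfl⟩ := hγ.exists_toGen_eq hS
  obtain ⟨σ, rfl⟩ := hγ'.exists_toGen_eq hT
  refine Or.inr ⟨(ρ, σ), rfl, rfl, ?_⟩
  rcases Ultrafilter.eventually_or.1 hmem' with hfin | hinf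
  · obtain ⟨g, hg⟩ := hfin.choice
    have hg1 := hg.mono fun t ht => ht.1
    have hg2 := hg.mono fun t ht => ht.2
    have t1 := tendsto_toBoundary_of_isShadow hS hS' l1 hg1 (fun t => hr (g t))
    have t2 := tendsto_toBoundary_of_isShadow hT hT' l2 hg2 (fun t => hs (α (g t)))
    have n1 := fun k => (GenRay.eventually_dist_add hS l1 hg1 k).mono fun t ht => ht.1
    have n2 := fun k => (GenRay.eventually_dist_add hT l2 hg2 k).mono fun t ht => ht.1
    have hne : ∀ᶠ t in (u : Filter (GenRay S × GenRay T)), g t ≠ 1 := by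
      filter_upwards [n1 1] with t ht h1
      rw [h1, wordNorm_one] at ht
      omega
    -- The ultrafilter decides which meeting condition holds. In either case the meeting times tend
    -- to infinity, because both `g t` and `α (g t)` do.
    rcases Ultrafilter.eventually_or.1 (hne.mono fun t ht => hα _ ht) with h | h
    · exact (eq_of_tendsto_of_meetBeyond hT hT' t2 ((f.continuous.tendsto _).comp t1) n1 h).symm
    · have := eq_of_tendsto_of_meetBeyond hS hS' t1 ((f.symm.continuous.tendsto _).comp t2) n2 h
      dsimp only
      rw [this, f.apply_symm_apply]
  · have : Nonempty (GeodesicRay S × GeodesicRay T) := ⟨(ρ, σ)⟩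
    obtain ⟨q, hq⟩ := hinf.choice
    have t1 : Tendsto (fun t => (q t).1) u (𝓝 ρ) := GenRay.tendsto_toGen_iff.1
      (l1.congr' (hq.mono fun t ht => ht.1.symm))
    have t2 : Tendsto (fun t => (q t).2) u (𝓝 σ) := GenRay.tendsto_toGen_iff.1
      (l2.congr' (hq.mono fun t ht => ht.2.1.symm))
    have := t2Space_gromovBoundary hT hT'
    exact tendsto_nhds_unique_of_eventuallyEq
      (((f.continuous.comp GeodesicRay.continuous_toBoundary).tendsto ρ).comp t1)
      ((GeodesicRay.continuous_toBoundary.tendsto σ).comp t2) (hq.mono fun t ht => ht.2.2)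

end Matching

end HypGroup

namespace HypGroup

open Monoid

/-! ### Word metric and hyperbolicity of free products. -/

section FreeProduct

open scoped Classical in
/-- The first syllable of `x` if it lies in the factor `G i`, and `1` otherwise. -/
noncomputable def head {ι : Type*} {G : ι → Type*} [∀ i, Group (G i)] (i : ι) (x : CoprodI G) :
    G i := (CoprodI.Word.equivPair i (CoprodI.Word.equiv x)).head

open scoped Classical in
/-- The sum of the word norms of the syllables. -/
noncomputable def syllableNorm {ι : Type*} {G : ι → Type*} [∀ i, Group (G i)]
    (S : ∀ i, Set (G i)) (x : CoprodI G) : ℕ :=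
  ((CoprodI.Word.equiv x).toList.map fun l => wordNorm (S l.1) l.2).sum

/-- The union of generating sets of the factors. -/
def unionGen {ι : Type*} {G : ι → Type*} [∀ i, Group (G i)] (S : ∀ i, Set (G i)) :
    Set (CoprodI G) := ⋃ i, CoprodI.of '' S i

variable {ι : Type*} {G : ι → Type*} [∀ i, Group (G i)] {S : ∀ i, Set (G i)}

open scoped Classical in
theorem equiv_of_mul_eq_smul {i : ι} (g : G i) (x : CoprodI G) :
    CoprodI.Word.equiv (CoprodI.of g * x) = CoprodI.of g • CoprodI.Word.equiv x := by
  exact mul_smul (CoprodI.of g) x (CoprodI.Word.empty : CoprodI.Word G)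

open scoped Classical in
theorem equiv_one : CoprodI.Word.equiv (1 : CoprodI G) = CoprodI.Word.empty := by
  exact one_smul (CoprodI G) (CoprodI.Word.empty : CoprodI.Word G)

open scoped Classical in
theorem head_of_mul {i : ι} (g : G i) (x : CoprodI G) :
    head i (CoprodI.of g * x) = g * head i x := by
  unfold head
  rw [equiv_of_mul_eq_smul, CoprodI.Word.equivPair_smul_same]

open scoped Classical in
theorem head_one (i : ι) : head i (1 : CoprodI G) = 1 := by
  unfold head
  rw [equiv_one, CoprodI.Word.equivPair_head]
  simp

theorem head_of (i : ι) (g : G i) : head i (CoprodI.of g) = g := by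
  simpa [head_one] using head_of_mul g 1

theorem head_inv_mul (i : ι) (x : CoprodI G) : head i ((CoprodI.of (head i x))⁻¹ * x) = 1 := by
  rw [← map_inv, head_of_mul, inv_mul_cancel]

open scoped Classical in
theorem fstIdx_equiv_ne {i : ι} {x : CoprodI G} (h : head i x = 1) :
    (CoprodI.Word.equiv x).fstIdx ≠ some i := by
  intro hi
  unfold head at h
  rw [CoprodI.Word.equivPair_head] at h
  generalize CoprodI.Word.equiv x = w at h hi
  rcases w with ⟨_ | ⟨⟨j, g⟩, l⟩, h1, h2⟩
  · simp [CoprodI.Word.fstIdx] at hi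
  · simp only [CoprodI.Word.fstIdx, List.head?_cons, Option.map_some, Option.some.injEq] at hi
    subst hi
    simp only [ne_eq, reduceCtorEq, not_false_eq_true, List.head_cons, exists_const,
      ↓reduceDIte] at h
    exact h1 _ List.mem_cons_self h

open scoped Classical in
theorem equiv_of_mul {i : ι} {g : G i} (hg : g ≠ 1) {x : CoprodI G} (h : head i x = 1) :
    CoprodI.Word.equiv (CoprodI.of g * x) =
      CoprodI.Word.cons g (CoprodI.Word.equiv x) (fstIdx_equiv_ne h) hg := by
  rw [CoprodI.Word.cons_eq_smul, equiv_of_mul_eq_smul]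

theorem head_eq_one_of_ne {i j : ι} {x : CoprodI G} (h : head i x ≠ 1) (hij : j ≠ i) :
    head j x = 1 := by
  classical
  unfold head at h ⊢
  rw [CoprodI.Word.equivPair_head] at h ⊢
  split_ifs at h with h1
  · rw [dif_neg]
    rintro ⟨a, b⟩
    obtain ⟨c, d⟩ := h1
    exact hij (b.symm.trans d)
  · exact absurd rfl h

theorem syllable_induction {motive : CoprodI G → Prop} (one : motive 1)
    (of_mul : ∀ (i : ι) (g : G i) (x : CoprodI G), g ≠ 1 → head i x = 1 → motive x →
      motive (CoprodI.of g * x)) (x : CoprodI G) : motive x := by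
  classical
  obtain ⟨w, rfl⟩ := (CoprodI.Word.equiv (M := G)).symm.surjective x
  induction w using CoprodI.Word.consRecOn with
  | empty => exact one
  | cons i g w h1 h2 ih =>
    have : CoprodI.Word.equiv.symm (CoprodI.Word.cons g w h1 h2) =
      CoprodI.of g * CoprodI.Word.equiv.symm w := CoprodI.Word.prod_cons i g w h2 h1
    rw [this]
    refine of_mul i g _ h2 ?_ ih
    unfold head
    convert! congrArg CoprodI.Word.Pair.head (CoprodI.Word.equivPair_eq_of_fstIdx_ne h1) using 2
    convert! congrArg _ (Equiv.apply_symm_apply CoprodI.Word.equiv w)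

theorem eq_one_of_forall_head {x : CoprodI G} (h : ∀ i, head i x = 1) : x = 1 := by
  induction x using syllable_induction with
  | one => rfl
  | of_mul i g x hg hx _ =>
    have := h i
    rw [head_of_mul, hx, mul_one] at this
    exact absurd this hg

theorem syllableNorm_one : syllableNorm S 1 = 0 := by
  simp [syllableNorm, equiv_one]

theorem syllableNorm_of_mul {i : ι} (g : G i) {x : CoprodI G} (hx : head i x = 1) :
    syllableNorm S (CoprodI.of g * x) = wordNorm (S i) g + syllableNorm S x := by
  classical
  by_cases hg : g = 1
  · simp [hg, wordNorm_one]
  · unfold syllableNorm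
    rw [equiv_of_mul hg hx]
    simp

theorem syllableNorm_of_mul_le (hS : ∀ i, IsFiniteGeneratingSet (S i)) {i : ι} (g : G i)
    (x : CoprodI G) : syllableNorm S (CoprodI.of g * x) ≤ wordNorm (S i) g + syllableNorm S x := by
  have h1 := syllableNorm_of_mul (S := S) (g * head i x) (head_inv_mul i x)
  have h2 := syllableNorm_of_mul (S := S) (head i x) (head_inv_mul i x)
  rw [map_mul, mul_assoc, mul_inv_cancel_left] at h1
  rw [mul_inv_cancel_left] at h2
  have := wordNorm_mul_le (hS i).2 g (head i x)
  omega

theorem closure_unionGen (hS : ∀ i, IsFiniteGeneratingSet (S i)) :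
    Subgroup.closure (unionGen S) = ⊤ := by
  refine eq_top_iff.2 fun x _ => ?_
  induction x using CoprodI.induction_on with
  | one => exact one_mem _
  | mul x y hx hy => exact mul_mem (hx trivial) (hy trivial)
  | of i g =>
    have : g ∈ Subgroup.closure (S i) := (hS i).2 ▸ Subgroup.mem_top g
    have h1 : CoprodI.of g ∈ (Subgroup.closure (S i)).map (CoprodI.of : G i →* CoprodI G) :=
      ⟨g, this, rfl⟩
    rw [MonoidHom.map_closure] at h1
    exact Subgroup.closure_mono (Set.subset_iUnion (fun i => CoprodI.of '' S i) i) h1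

theorem isFiniteGeneratingSet_unionGen [Finite ι] (hS : ∀ i, IsFiniteGeneratingSet (S i)) :
    IsFiniteGeneratingSet (unionGen S) :=
  ⟨Set.finite_iUnion fun i => (hS i).1.image _, closure_unionGen hS⟩

theorem wordNorm_unionGen (hS : ∀ i, IsFiniteGeneratingSet (S i)) (x : CoprodI G) :
    wordNorm (unionGen S) x = syllableNorm S x := by
  have hU := closure_unionGen hS
  have hof : ∀ i (g : G i), wordNorm (unionGen S) (CoprodI.of g) ≤ wordNorm (S i) g := by
    intro i g
    have := le_add_mul_wordDist (hS i).2 (fun g => wordNorm (unionGen S) (CoprodI.of g)) 1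
      (fun g s hs => ?_) 1 g
    · simpa [wordDist_self, wordNorm] using this
    · have hs' : wordNorm (unionGen S) (CoprodI.of s) ≤ 1 :=
        wordNorm_le_one (Set.mem_iUnion.2 ⟨i, s, hs, rfl⟩)
      have h1 := wordNorm_mul_le hU (CoprodI.of g) (CoprodI.of s)
      have h2 := wordNorm_mul_le hU (CoprodI.of (g * s)) (CoprodI.of s)⁻¹
      rw [wordNorm_inv, map_mul, mul_inv_cancel_right] at h2
      simp only [map_mul]
      omega
  apply le_antisymm
  · induction x using syllable_induction with
    | one => rw [wordNorm_one]; omega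
    | of_mul i g x hg hx ih =>
      rw [syllableNorm_of_mul g hx]
      exact (wordNorm_mul_le hU _ _).trans (Nat.add_le_add (hof i g) ih)
  -- Reduced words are understood under left multiplication, whereas Cayley edges multiply on the
  -- right; hence the inverses.
  · have := le_add_mul_wordDist hU (fun x => syllableNorm S x⁻¹) 1 (fun x s hmem => ?_) 1 x⁻¹
    · simp only [inv_inv, inv_one, syllableNorm_one, zero_add, one_mul] at this
      rwa [← wordNorm, wordNorm_inv] at this
    · obtain ⟨i, s, hs, rfl⟩ := Set.mem_iUnion.1 hmem
      have hs' := wordNorm_le_one hs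
      have h1 := syllableNorm_of_mul_le hS s⁻¹ x⁻¹
      have h2 := syllableNorm_of_mul_le hS s (x * CoprodI.of s)⁻¹
      rw [wordNorm_inv] at h1
      rw [mul_inv_rev, mul_inv_cancel_left] at h2
      rw [map_inv, ← mul_inv_rev] at h1
      rw [← mul_inv_rev] at h2
      omega

theorem wordNorm_of_mul (hS : ∀ i, IsFiniteGeneratingSet (S i)) {i : ι} (g : G i)
    {x : CoprodI G} (hx : head i x = 1) :
    wordNorm (unionGen S) (CoprodI.of g * x) = wordNorm (S i) g + wordNorm (unionGen S) x := by
  rw [wordNorm_unionGen hS, wordNorm_unionGen hS, syllableNorm_of_mul g hx]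

theorem wordNorm_eq_head_add (hS : ∀ i, IsFiniteGeneratingSet (S i)) (i : ι) (x : CoprodI G) :
    wordNorm (unionGen S) x = wordNorm (S i) (head i x) +
      wordNorm (unionGen S) ((CoprodI.of (head i x))⁻¹ * x) := by
  rw [← wordNorm_of_mul hS _ (head_inv_mul i x), mul_inv_cancel_left]

/-- The reduced words of `x⁻¹` and `z` concatenate without cancellation or merging, since `z` starts
in `G i` and `x` does not. -/
theorem wordNorm_inv_mul (hS : ∀ i, IsFiniteGeneratingSet (S i)) (x : CoprodI G) :
    ∀ (i : ι) (z : CoprodI G), head i x = 1 → head i z ≠ 1 →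
      wordNorm (unionGen S) (x⁻¹ * z) = wordNorm (unionGen S) x + wordNorm (unionGen S) z := by
  induction x using syllable_induction with
  | one => intro i z _ _; simp [wordNorm_one]
  | of_mul j g x hg hx ih =>
    intro i z h1 h2
    have hij : j ≠ i := by
      rintro rfl
      rw [head_of_mul, hx, mul_one] at h1
      exact hg h1
    have h3 := head_eq_one_of_ne h2 hij
    have h4 := ih j (CoprodI.of g⁻¹ * z) hx (by rwa [head_of_mul, h3, mul_one, inv_ne_one])
    rw [wordNorm_of_mul hS _ h3, wordNorm_inv] at h4
    rw [mul_inv_rev, mul_assoc, ← map_inv, h4, wordNorm_of_mul hS _ hx]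
    omega

/-- In the tree of cosets, a path between points with different projections to `G i` must enter `G
i` at one projection and leave it at the other. -/
theorem wordDist_of_head_ne (hS : ∀ i, IsFiniteGeneratingSet (S i)) {i : ι} {x y : CoprodI G}
    (h : head i x ≠ head i y) :
    wordDist (unionGen S) x y = wordNorm (unionGen S) ((CoprodI.of (head i x))⁻¹ * x) +
      wordDist (S i) (head i x) (head i y) +
      wordNorm (unionGen S) ((CoprodI.of (head i y))⁻¹ * y) := by
  have h1 : x⁻¹ * y = ((CoprodI.of (head i x))⁻¹ * x)⁻¹ *
      (CoprodI.of ((head i x)⁻¹ * head i y) * ((CoprodI.of (head i y))⁻¹ * y)) := by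
    simp only [map_mul, map_inv]
    group
  rw [wordDist_eq, h1, wordNorm_inv_mul hS _ i _ (head_inv_mul i x),
    wordNorm_of_mul hS _ (head_inv_mul i y), wordDist_eq (head i x)]
  · omega
  · rw [head_of_mul, head_inv_mul, mul_one]
    intro hc
    exact h (inv_mul_eq_one.1 hc)

theorem wordDist_head_le (hS : ∀ i, IsFiniteGeneratingSet (S i)) (i : ι) (x y : CoprodI G) :
    wordDist (S i) (head i x) (head i y) ≤ wordDist (unionGen S) x y := by
  by_cases h : head i x = head i y
  · rw [h, wordDist_self]; omega
  · rw [wordDist_of_head_ne hS h]; omega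

/-- By translation the fourth point is `1`. A common first syllable is stripped off by induction.
Otherwise the heads in some factor are not all equal: distances split through that factor, and
either its own four-point condition or, when two heads agree, triangle inequalities conclude. -/
theorem fourPoint_unionGen_aux (hS : ∀ i, IsFiniteGeneratingSet (S i)) {δ : ℕ}
    (h4 : ∀ i, FourPoint (wordDist (S i)) δ) (n : ℕ) : ∀ x y z : CoprodI G,
    wordNorm (unionGen S) x ≤ n →
    wordDist (unionGen S) x y + wordNorm (unionGen S) z ≤
      max (wordDist (unionGen S) x z + wordNorm (unionGen S) y)
        (wordNorm (unionGen S) x + wordDist (unionGen S) y z) + δ := by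
  induction n using Nat.strong_induction_on with | _ n ih => ?_
  intro x y z hn
  have hU := isGraphDist_wordDist (closure_unionGen hS)
  by_cases heq : ∀ i, head i x = head i y ∧ head i x = head i z
  · by_cases h1 : ∀ i, head i x = 1
    · rw [eq_one_of_forall_head h1,
        eq_one_of_forall_head fun i => (heq i).1.symm.trans (h1 i),
        eq_one_of_forall_head fun i => (heq i).2.symm.trans (h1 i), wordDist_self]
      omega
    · obtain ⟨i, hi⟩ := not_forall.1 h1
      have hx := wordNorm_eq_head_add hS i x
      have hy := wordNorm_eq_head_add hS i y
      have hz := wordNorm_eq_head_add hS i z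
      rw [← (heq i).1] at hy
      rw [← (heq i).2] at hz
      have hpos : wordNorm (S i) (head i x) ≠ 0 := fun h => hi (wordNorm_eq_zero (hS i).2 h)
      have := ih (n - 1) (by omega) ((CoprodI.of (head i x))⁻¹ * x)
        ((CoprodI.of (head i x))⁻¹ * y) ((CoprodI.of (head i x))⁻¹ * z) (by omega)
      simp only [wordDist_mul_left] at this
      rcases max_cases (wordDist (unionGen S) x z +
        wordNorm (unionGen S) ((CoprodI.of (head i x))⁻¹ * y))
        (wordNorm (unionGen S) ((CoprodI.of (head i x))⁻¹ * x) + wordDist (unionGen S) y z)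
        with h | h <;> omega
  · simp only [not_forall] at heq
    obtain ⟨i, hi⟩ := heq
    have hx := wordNorm_eq_head_add hS i x
    have hy := wordNorm_eq_head_add hS i y
    have hz := wordNorm_eq_head_add hS i z
    have hd := isGraphDist_wordDist (hS i).2
    have l1 := le_max_left (wordDist (unionGen S) x z + wordNorm (unionGen S) y)
      (wordNorm (unionGen S) x + wordDist (unionGen S) y z)
    have l2 := le_max_right (wordDist (unionGen S) x z + wordNorm (unionGen S) y)
      (wordNorm (unionGen S) x + wordDist (unionGen S) y z)
    have t1 := hd.tri 1 (head i x) (head i z)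
    have t2 := hd.tri 1 (head i y) (head i z)
    have t3 := hd.tri 1 (head i z) (head i x)
    have c1 := hd.comm (head i z) (head i x)
    by_cases hxy : head i x = head i y
    · have hxz : head i x ≠ head i z := fun h => hi ⟨hxy, h⟩
      have e1 := wordDist_of_head_ne hS hxz
      have e2 := wordDist_mul_left (S := unionGen S) (CoprodI.of (head i x))⁻¹ x y
      have e3 := hU.tri ((CoprodI.of (head i x))⁻¹ * x) 1 ((CoprodI.of (head i x))⁻¹ * y)
      have e4 := hU.comm ((CoprodI.of (head i x))⁻¹ * x) 1
      rw [← hxy] at hy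
      simp only [wordNorm] at *
      omega
    · have e1 := wordDist_of_head_ne hS hxy
      by_cases hxz : head i x = head i z
      · have e2 := wordDist_of_head_ne hS (x := y) (y := z) (i := i)
          (fun h => hxy (hxz.trans h.symm))
        have c2 := hd.comm (head i x) (head i y)
        rw [← hxz] at e2 hz
        simp only [wordNorm] at *
        omega
      · have e2 := wordDist_of_head_ne hS hxz
        by_cases hyz : head i y = head i z
        · rw [← hyz] at hz e2
          simp only [wordNorm] at *
          omega
        · have e3 := wordDist_of_head_ne hS hyz
          have h5 := h4 i (head i x) (head i y) (head i z) 1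
          have c2 := hd.comm (head i x) 1
          have c3 := hd.comm (head i y) 1
          have c4 := hd.comm (head i z) 1
          simp only [wordNorm] at *
          rcases max_cases (wordDist (S i) (head i x) (head i z) + wordDist (S i) (head i y) 1)
            (wordDist (S i) (head i x) 1 + wordDist (S i) (head i y) (head i z)) with h | h <;>
          omega

theorem isHyperbolicWith_unionGen [Finite ι] (hS : ∀ i, IsFiniteGeneratingSet (S i))
    (h : ∀ i, IsHyperbolicWith (S i)) : IsHyperbolicWith (unionGen S) := by
  choose δ hδ using h
  obtain ⟨D, hD⟩ := (Set.finite_range δ).bddAbove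
  have h4 : ∀ i, FourPoint (wordDist (S i)) D := fun i x y z w =>
    (hδ i x y z w).trans (Nat.add_le_add_left (hD ⟨i, rfl⟩) _)
  refine ⟨D, fun x y z w => ?_⟩
  have := fourPoint_unionGen_aux hS h4 _ (w⁻¹ * x) (w⁻¹ * y) (w⁻¹ * z) le_rfl
  simp only [wordDist_mul_left, ← wordDist_eq] at this
  rwa [wordDist_comm w x, wordDist_comm w y, wordDist_comm w z] at this

theorem head_inv_mul_of_ne_one (u : CoprodI G) : ∀ (j : ι) (z : CoprodI G), u ≠ 1 →
    head j u = 1 → head j z ≠ 1 → ∀ i, head i (u⁻¹ * z) = head i u⁻¹ := by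
  induction u using syllable_induction with
  | one => intro j z h; exact absurd rfl h
  | of_mul k b u hb hu ih =>
    intro j z _ h1 h2 i
    have hkj : k ≠ j := by
      rintro rfl
      rw [head_of_mul, hu, mul_one] at h1
      exact hb h1
    have h3 := head_eq_one_of_ne h2 hkj
    have h4 : head k (CoprodI.of b⁻¹ * z) ≠ 1 := by
      rwa [head_of_mul, h3, mul_one, inv_ne_one]
    have h5 : head k (CoprodI.of b⁻¹ : CoprodI G) ≠ 1 := by rwa [head_of, inv_ne_one]
    rw [mul_inv_rev, mul_assoc, ← map_inv]
    by_cases h6 : u = 1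
    · simp only [h6, inv_one, one_mul]
      by_cases hik : i = k
      · subst hik
        rw [head_of_mul, h3, mul_one, head_of]
      · rw [head_eq_one_of_ne h4 hik, head_eq_one_of_ne h5 hik]
    · rw [ih k _ h6 hu h4, ih k _ h6 hu h5]

end FreeProduct

/-! ### Syllable-wise bijections of free products. -/

section Letterwise

variable {ι : Type*} {G H : ι → Type*} [∀ i, Group (G i)] [∀ i, Group (H i)]

open scoped Classical in
/-- Replace each syllable of a reduced word by its image under bijections of the factors. -/
noncomputable def letterwise (α : ∀ i, G i ≃ H i) (hα : ∀ i, α i 1 = 1) (x : CoprodI G) :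
    CoprodI H :=
  CoprodI.Word.prod
    { toList := (CoprodI.Word.equiv x).toList.map fun l => ⟨l.1, α l.1 l.2⟩
      ne_one := by
        intro l hl
        obtain ⟨l', h1, rfl⟩ := List.mem_map.1 hl
        intro h
        exact (CoprodI.Word.equiv x).ne_one _ h1 ((α l'.1).injective (h.trans (hα _).symm))
      chain_ne := by
        rw [List.isChain_map]
        exact (CoprodI.Word.equiv x).chain_ne }

variable (α : ∀ i, G i ≃ H i) (hα : ∀ i, α i 1 = 1)

theorem letterwise_one : letterwise α hα 1 = 1 := by
  simp [letterwise, CoprodI.Word.prod, equiv_one]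

theorem letterwise_of_mul {i : ι} (g : G i) {x : CoprodI G} (hx : head i x = 1) :
    letterwise α hα (CoprodI.of g * x) = CoprodI.of (α i g) * letterwise α hα x := by
  classical
  by_cases hg : g = 1
  · simp [hg, hα]
  · unfold letterwise CoprodI.Word.prod
    simp only [equiv_of_mul hg hx]
    simp

theorem head_letterwise (i : ι) (x : CoprodI G) :
    head i (letterwise α hα x) = α i (head i x) := by
  induction x using syllable_induction generalizing i with
  | one => rw [letterwise_one, head_one, head_one, hα]
  | of_mul j g x hg hx ih =>
    have h1 : head j (letterwise α hα x) = 1 := by rw [ih, hx, hα]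
    rw [letterwise_of_mul α hα g hx]
    by_cases hij : i = j
    · subst hij
      rw [head_of_mul, h1, mul_one, head_of_mul, hx, mul_one]
    · have h2 : head j (CoprodI.of (α j g) * letterwise α hα x) ≠ 1 := by
        rw [head_of_mul, h1, mul_one]
        exact fun h => hg ((α j).injective (h.trans (hα j).symm))
      have h3 : head j (CoprodI.of g * x) ≠ 1 := by rwa [head_of_mul, hx, mul_one]
      rw [head_eq_one_of_ne h2 hij, head_eq_one_of_ne h3 hij, hα]

theorem symm_apply_one {A B : Type*} [One A] [One B] {e : A ≃ B} (h : e 1 = 1) : e.symm 1 = 1 := by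
  rw [← h, e.symm_apply_apply]

theorem letterwise_symm_letterwise (x : CoprodI G) :
    letterwise (fun i => (α i).symm) (fun i => symm_apply_one (hα i)) (letterwise α hα x) = x := by
  induction x using syllable_induction with
  | one => rw [letterwise_one, letterwise_one]
  | of_mul i g x hg hx ih =>
    rw [letterwise_of_mul α hα g hx, letterwise_of_mul, ih, Equiv.symm_apply_apply]
    rw [head_letterwise, hx, hα]

theorem letterwise_letterwise_symm (x : CoprodI H) :
    letterwise α hα (letterwise (fun i => (α i).symm) (fun i => symm_apply_one (hα i)) x) = x :=
  letterwise_symm_letterwise (fun i => (α i).symm) (fun i => symm_apply_one (hα i)) x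

theorem letterwise_injective : Function.Injective (letterwise α hα) :=
  Function.LeftInverse.injective (letterwise_symm_letterwise α hα)

/-- The hypothesis says that `w` does not end in `G i`. Then `head i (w⁻¹ * x)` is either the
syllable of `x` following the prefix `w`, or `1`; both are respected by `letterwise`. If `w` ended
in `G i`, quotients of syllables would appear, which `α` does not respect. -/
theorem head_inv_mul_letterwise (w : CoprodI G) : ∀ (i : ι) (x : CoprodI G), head i w⁻¹ = 1 →
    head i ((letterwise α hα w)⁻¹ * letterwise α hα x) = α i (head i (w⁻¹ * x)) := by
  induction w using syllable_induction with
  | one => intro i x _; simp [letterwise_one, head_letterwise]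
  | of_mul j a w ha hw ih =>
    intro i x h
    have h1 : head j (CoprodI.of a⁻¹ : CoprodI G) ≠ 1 := by rwa [head_of, inv_ne_one]
    have h2 : head j (letterwise α hα w) = 1 := by rw [head_letterwise, hw, hα]
    have h3 : head i w⁻¹ = 1 := by
      by_cases hw1 : w = 1
      · rw [hw1, inv_one, head_one]
      · rw [← head_inv_mul_of_ne_one w j _ hw1 hw h1 i]
        rwa [mul_inv_rev, ← map_inv] at h
    have hne : w = 1 → i ≠ j := by
      rintro rfl rfl
      rw [mul_one, ← map_inv] at h
      exact h1 h
    have e1 : ∀ x, (CoprodI.of a * w)⁻¹ * x = w⁻¹ * (CoprodI.of a⁻¹ * x) := by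
      intro x; rw [mul_inv_rev, mul_assoc, map_inv]
    have e2 : ∀ y, (letterwise α hα (CoprodI.of a * w))⁻¹ * y =
        (letterwise α hα w)⁻¹ * (CoprodI.of (α j a)⁻¹ * y) := by
      intro y; rw [letterwise_of_mul α hα a hw, mul_inv_rev, mul_assoc, map_inv]
    rw [e1, e2]
    by_cases hx : head j x = a
    · have h4 : x = CoprodI.of a * ((CoprodI.of a)⁻¹ * x) := (mul_inv_cancel_left _ _).symm
      have h5 : letterwise α hα x = CoprodI.of (α j a) * letterwise α hα ((CoprodI.of a)⁻¹ * x) := by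
        conv_lhs => rw [h4]
        refine letterwise_of_mul α hα a ?_
        have := head_inv_mul j x
        rwa [hx] at this
      rw [h5, map_inv, inv_mul_cancel_left, map_inv]
      exact ih i _ h3
    · have h4 : head j (CoprodI.of a⁻¹ * x) ≠ 1 := by
        rw [head_of_mul]
        exact fun h => hx (inv_mul_eq_one.1 h).symm
      have h5 : head j (CoprodI.of (α j a)⁻¹ * letterwise α hα x) ≠ 1 := by
        rw [head_of_mul, head_letterwise]
        exact fun h => hx ((α j).injective (inv_mul_eq_one.1 h)).symm
      by_cases hw1 : w = 1
      · simp only [hw1, letterwise_one, inv_one, one_mul]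
        rw [head_eq_one_of_ne h4 (hne hw1), head_eq_one_of_ne h5 (hne hw1), hα]
      · have hw1' : letterwise α hα w ≠ 1 := fun h => hw1
          (letterwise_injective α hα (h.trans (letterwise_one α hα).symm))
        have h6 := ih i 1 h3
        rw [letterwise_one, mul_one, mul_one, h3, hα] at h6
        rw [head_inv_mul_of_ne_one w j _ hw1 hw h4,
          head_inv_mul_of_ne_one _ j _ hw1' h2 h5, h3, h6, hα]

end Letterwise

end HypGroup

namespace HypGroup

open Monoid Filter Topology

theorem GenRay.isInfinite_of_tendsto_of_injective {G : Type*} [Group G] {S : Set G}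
    (hS : IsFiniteGeneratingSet S) {v : ℕ → G} (hv : Function.Injective v) {γ : ℕ → GenRay S}
    (hγ : ∀ n, (γ n).EndsAt (v n)) {ρ : GenRay S} (h : Tendsto γ (hyperfilter ℕ) (𝓝 ρ)) :
    ρ.IsInfinite := by
  intro k
  have hfin : {n | wordNorm S (v n) ≤ k}.Finite := (finite_wordNorm_le hS k).preimage hv.injOn
  obtain ⟨n, h1, h2⟩ := ((GenRay.tendsto_iff.1 h k).and
    (compl_mem_hyperfilter_of_finite hfin : ∀ᶠ n in (hyperfilter ℕ : Filter ℕ), _)).exists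
  rw [← h1]
  exact ((hγ n).dist_add hS (not_le.1 h2).le).1

/-! ### Generalized rays with the same end. -/

section SameEnd

variable {G H : Type*} [Group G] [Group H] {S : Set G} {T : Set H}

/-- The generalized rays end at the same element or the same boundary point. -/
def SameEnd (γ γ' : GenRay S) : Prop :=
  (∃ g, γ.EndsAt g ∧ γ'.EndsAt g) ∨
    ∃ q : GeodesicRay S × GeodesicRay S, q.1.toGen = γ ∧ q.2.toGen = γ' ∧ raySetoid S q.1 q.2

theorem GeodesicRay.toGen_injective : Function.Injective (GeodesicRay.toGen (S := S)) := by
  intro ρ σ h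
  exact Subtype.ext (congrArg (fun γ : GenRay S => γ.1) h)

theorem GenRay.EndsAt.ne_toGen {γ : GenRay S} {g : G} (h : γ.EndsAt g) (ρ : GeodesicRay S) :
    ρ.toGen ≠ γ := by
  rintro rfl
  exact h.not_isInfinite ρ.isInfinite_toGen

theorem sameEnd_toGen_iff {ρ σ : GeodesicRay S} :
    SameEnd ρ.toGen σ.toGen ↔ ρ.toBoundary = σ.toBoundary := by
  rw [GeodesicRay.toBoundary_eq_iff]
  constructor
  · rintro (⟨c, hc, -⟩ | ⟨q, h1, h2, h3⟩)
    · exact absurd rfl (hc.ne_toGen ρ)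
    · rwa [GeodesicRay.toGen_injective h1, GeodesicRay.toGen_injective h2] at h3
  · intro h
    exact Or.inr ⟨(ρ, σ), rfl, rfl, h⟩

theorem GeodesicRay.injective (ρ : GeodesicRay S) : Function.Injective ρ.1 := by
  intro m n h
  rw [← ρ.norm_eq m, ← ρ.norm_eq n, h]

theorem sameEnd_iff_of_mem_rayCorrespondence {α : G ≃ H}
    {f : GromovBoundary S ≃ₜ GromovBoundary T} {γ γ' : GenRay S} {η η' : GenRay T}
    (h : (γ, η) ∈ rayCorrespondence α f) (h' : (γ', η') ∈ rayCorrespondence α f) :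
    SameEnd γ γ' ↔ SameEnd η η' := by
  rcases h with ⟨g, h1, h2⟩ | ⟨⟨ρ, σ⟩, rfl, rfl, h1⟩ <;>
  rcases h' with ⟨g', h1', h2'⟩ | ⟨⟨ρ', σ'⟩, rfl, rfl, h1'⟩
  · constructor
    · rintro (⟨a, ha, ha'⟩ | ⟨q, ha, -⟩)
      · exact Or.inl ⟨α g, h2, by rwa [h1.unique ha, ← h1'.unique ha']⟩
      · exact absurd ha (h1.ne_toGen _)
    · rintro (⟨a, ha, ha'⟩ | ⟨q, ha, -⟩)
      · have := α.injective ((h2.unique ha).trans (h2'.unique ha').symm)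
        exact Or.inl ⟨g, h1, this ▸ h1'⟩
      · exact absurd ha (h2.ne_toGen _)
  · refine iff_of_false ?_ ?_
    · rintro (⟨a, -, ha⟩ | ⟨q, ha, -⟩)
      · exact ha.ne_toGen _ rfl
      · exact h1.ne_toGen _ ha
    · rintro (⟨a, -, ha⟩ | ⟨q, ha, -⟩)
      · exact ha.ne_toGen _ rfl
      · exact h2.ne_toGen _ ha
  · refine iff_of_false ?_ ?_
    · rintro (⟨a, ha, -⟩ | ⟨q, -, ha, -⟩)
      · exact ha.ne_toGen _ rfl
      · exact h1'.ne_toGen _ ha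
    · rintro (⟨a, ha, -⟩ | ⟨q, -, ha, -⟩)
      · exact ha.ne_toGen _ rfl
      · exact h2'.ne_toGen _ ha
  · rw [sameEnd_toGen_iff, sameEnd_toGen_iff]
    change f ρ.toBoundary = σ.toBoundary at h1
    change f ρ'.toBoundary = σ'.toBoundary at h1'
    rw [← h1, ← h1', f.injective.eq_iff]

/-- Finite geodesics with a common end agree once both have arrived, so a difference at time `k`
means that neither has stopped before time `k`. -/
theorem SameEnd.of_ne (hS : IsFiniteGeneratingSet S) {δ : ℕ} (h4 : FourPoint (wordDist S) δ)
    {γ γ' : GenRay S} (h : SameEnd γ γ') {k : ℕ} (hk : γ.1 k ≠ γ'.1 k) :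
    wordNorm S (γ.1 k) = k ∧ wordNorm S (γ'.1 k) = k ∧ wordDist S (γ.1 k) (γ'.1 k) ≤ 2 * δ := by
  rcases h with ⟨g, h1, h2⟩ | ⟨q, rfl, rfl, h⟩
  · have hle : k ≤ wordNorm S g := by
      by_contra! hc
      exact hk ((h1.apply hS hc.le).trans (h2.apply hS hc.le).symm)
    refine ⟨(h1.dist_add hS hle).1, (h2.dist_add hS hle).1, ?_⟩
    have := GenRay.dist_le_of_endsAt hS h4 h1 h2 k
    omega
  · exact ⟨q.1.norm_eq k, q.2.norm_eq k, GeodesicRay.dist_le_of_equiv h4 h k⟩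

end SameEnd

/-! ### Projections of rays to the cosets of the factors. -/

section Projection

variable {ι : Type*} {G : ι → Type*} [∀ i, Group (G i)] {S : ∀ i, Set (G i)}

theorem wordNorm_eq_add_of_head_ne_one (hS : ∀ i, IsFiniteGeneratingSet (S i)) {i : ι}
    {w x : CoprodI G} (hw : head i w⁻¹ = 1) (hx : head i (w⁻¹ * x) ≠ 1) :
    wordNorm (unionGen S) x = wordNorm (unionGen S) w + wordNorm (unionGen S) (w⁻¹ * x) := by
  have := wordNorm_inv_mul hS w⁻¹ i (w⁻¹ * x) hw hx
  rwa [inv_inv, mul_inv_cancel_left, wordNorm_inv] at this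

/-- The projection of a generalized ray to the coset of `G i` represented by `w`. -/
noncomputable def projRay (hS : ∀ i, IsFiniteGeneratingSet (S i)) (i : ι) (w : CoprodI G)
    (hw : head i w⁻¹ = 1) (ρ : GenRay (unionGen S)) : GenRay (S i) :=
  ⟨fun n => head i (w⁻¹ * ρ.1 (wordNorm (unionGen S) w + n)), by
    change head i (w⁻¹ * ρ.1 (wordNorm (unionGen S) w + 0)) = 1
    by_contra hne
    have h1 := wordNorm_eq_add_of_head_ne_one hS hw hne
    have h2 := ρ.norm_le (wordNorm (unionGen S) w + 0)
    have h3 := wordNorm_eq_head_add hS i (w⁻¹ * ρ.1 (wordNorm (unionGen S) w + 0))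
    exact hne (wordNorm_eq_zero (hS i).2 (by omega)), by
    intro n
    change head i (w⁻¹ * ρ.1 (wordNorm (unionGen S) w + n + 1)) =
      head i (w⁻¹ * ρ.1 (wordNorm (unionGen S) w + n)) ∨
      (wordNorm (S i) (head i (w⁻¹ * ρ.1 (wordNorm (unionGen S) w + n + 1))) = n + 1 ∧
      wordDist (S i) (head i (w⁻¹ * ρ.1 (wordNorm (unionGen S) w + n)))
        (head i (w⁻¹ * ρ.1 (wordNorm (unionGen S) w + n + 1))) ≤ 1)
    rcases ρ.2.2 (wordNorm (unionGen S) w + n) with h | ⟨h1, h2⟩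
    · left
      rw [h]
    · set x := ρ.1 (wordNorm (unionGen S) w + n)
      set y := ρ.1 (wordNorm (unionGen S) w + n + 1)
      by_cases hxy : head i (w⁻¹ * y) = head i (w⁻¹ * x)
      · exact Or.inl hxy
      · right
        rw [← wordDist_mul_left w⁻¹] at h2
        -- Different projections already use up the single edge from `x` to `y`, so both points lie
        -- in the coset itself.
        have h3 := wordDist_of_head_ne hS (Ne.symm hxy)
        have hpos : wordDist (S i) (head i (w⁻¹ * x)) (head i (w⁻¹ * y)) ≠ 0 := fun h =>
          hxy ((isGraphDist_wordDist (hS i).2).eq_of _ _ h).symm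
        have h4 := wordNorm_eq_head_add hS i (w⁻¹ * y)
        refine ⟨?_, by omega⟩
        -- A trivial projection would give `y = w`, which has too small a norm.
        by_cases hy : head i (w⁻¹ * y) = 1
        · exfalso
          rw [hy, wordNorm_one] at h4
          have h5 := wordNorm_eq_zero (closure_unionGen hS)
            (show wordNorm (unionGen S) (w⁻¹ * y) = 0 by rw [hy] at h3 hpos; omega)
          rw [← inv_mul_eq_one.1 h5] at h1
          omega
        · have := wordNorm_eq_add_of_head_ne_one hS hw hy
          omega⟩

theorem tendsto_projRay (hS : ∀ i, IsFiniteGeneratingSet (S i)) (i : ι) {w : CoprodI G}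
    (hw : head i w⁻¹ = 1) {T : Type*} {F : Filter T} {γ : T → GenRay (unionGen S)}
    {ρ : GenRay (unionGen S)} (h : Tendsto γ F (𝓝 ρ)) :
    Tendsto (fun t => projRay hS i w hw (γ t)) F (𝓝 (projRay hS i w hw ρ)) := by
  refine GenRay.tendsto_iff.2 fun n => ?_
  filter_upwards [GenRay.tendsto_iff.1 h (wordNorm (unionGen S) w + n)] with t ht
  simp only [projRay, ht]

theorem GenRay.EndsAt.projRay (hS : ∀ i, IsFiniteGeneratingSet (S i)) (i : ι) {w : CoprodI G}
    (hw : head i w⁻¹ = 1) {ρ : GenRay (unionGen S)} {x : CoprodI G} (h : ρ.EndsAt x) :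
    (projRay hS i w hw ρ).EndsAt (head i (w⁻¹ * x)) := by
  obtain ⟨N, hN⟩ := h
  exact ⟨N, fun n hn => by
    change head i (w⁻¹ * ρ.1 (wordNorm (unionGen S) w + n)) = _
    rw [hN _ (by omega)]⟩

theorem dist_projRay_le (hS : ∀ i, IsFiniteGeneratingSet (S i)) (i : ι) {w : CoprodI G}
    (hw : head i w⁻¹ = 1) (ρ σ : GenRay (unionGen S)) (n : ℕ) :
    wordDist (S i) ((projRay hS i w hw ρ).1 n) ((projRay hS i w hw σ).1 n) ≤
      wordDist (unionGen S) (ρ.1 (wordNorm (unionGen S) w + n))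
        (σ.1 (wordNorm (unionGen S) w + n)) := by
  rw [← wordDist_mul_left w⁻¹]
  exact wordDist_head_le hS i _ _

/-- Take for `w` the product of the common initial syllables of `x` and `y`; the first syllables
after it distinguish them. -/
theorem exists_branching (hS : ∀ i, IsFiniteGeneratingSet (S i)) (x : CoprodI G) :
    ∀ y, x ≠ y → ∃ w i,
      wordNorm (unionGen S) w + wordNorm (unionGen S) (w⁻¹ * x) = wordNorm (unionGen S) x ∧
      wordNorm (unionGen S) w + wordNorm (unionGen S) (w⁻¹ * y) = wordNorm (unionGen S) y ∧
      head i (w⁻¹ * x) ≠ head i (w⁻¹ * y) := by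
  have hU := closure_unionGen hS
  have triv : ∀ x y : CoprodI G, ∀ i, head i x ≠ head i y → ∃ w i,
      wordNorm (unionGen S) w + wordNorm (unionGen S) (w⁻¹ * x) = wordNorm (unionGen S) x ∧
      wordNorm (unionGen S) w + wordNorm (unionGen S) (w⁻¹ * y) = wordNorm (unionGen S) y ∧
      head i (w⁻¹ * x) ≠ head i (w⁻¹ * y) := fun x y i h =>
    ⟨1, i, by simp [wordNorm_one], by simp [wordNorm_one], by simpa using h⟩
  induction x using syllable_induction with
  | one =>
    intro y hy
    have : ¬ ∀ i, head i y = 1 := fun h => hy (eq_one_of_forall_head h).symm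
    obtain ⟨i, hi⟩ := not_forall.1 this
    exact triv _ _ i (by rw [head_one]; exact Ne.symm hi)
  | of_mul j g x hg hx ih =>
    intro y hy
    by_cases hj : head j y = g
    · have hy' := head_inv_mul j y
      have hye := wordNorm_eq_head_add hS j y
      rw [hj] at hy' hye
      obtain ⟨w, i, h1, h2, h3⟩ := ih ((CoprodI.of g)⁻¹ * y) (by
        rintro rfl
        exact hy (mul_inv_cancel_left _ _))
      have e1 : (CoprodI.of g * w)⁻¹ * (CoprodI.of g * x) = w⁻¹ * x := by group
      have e2 : (CoprodI.of g * w)⁻¹ * y = w⁻¹ * ((CoprodI.of g)⁻¹ * y) := by group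
      have h4 := wordNorm_mul_le hU (CoprodI.of g) w
      have h5 := wordNorm_mul_le hU (CoprodI.of g * w) ((CoprodI.of g * w)⁻¹ * y)
      have h6 := wordNorm_mul_le hU (CoprodI.of g * w)
        ((CoprodI.of g * w)⁻¹ * (CoprodI.of g * x))
      have h7 := wordNorm_of_mul hS g (head_one j)
      rw [mul_one, wordNorm_one, add_zero] at h7
      have h8 := wordNorm_of_mul hS g hx
      rw [mul_inv_cancel_left] at h5 h6
      rw [e2] at h5
      rw [e1] at h6
      refine ⟨CoprodI.of g * w, i, ?_, ?_, ?_⟩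
      · rw [e1]; omega
      · rw [e2]; omega
      · rwa [e1, e2]
    · exact triv _ _ j (by rw [head_of_mul, hx, mul_one]; exact Ne.symm hj)

/-- If `w` ends in `G i`, deleting its last syllable gives a shorter representative of the same
coset, and the two projections change by a common left factor. -/
theorem exists_branching_of_ne (hS : ∀ i, IsFiniteGeneratingSet (S i)) {x y : CoprodI G}
    (h : x ≠ y) : ∃ w i, head i w⁻¹ = 1 ∧
      wordNorm (unionGen S) w + wordNorm (unionGen S) (w⁻¹ * x) = wordNorm (unionGen S) x ∧
      wordNorm (unionGen S) w + wordNorm (unionGen S) (w⁻¹ * y) = wordNorm (unionGen S) y ∧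
      head i (w⁻¹ * x) ≠ head i (w⁻¹ * y) := by
  have hU := closure_unionGen hS
  suffices H : ∀ n w i, wordNorm (unionGen S) w = n →
      wordNorm (unionGen S) w + wordNorm (unionGen S) (w⁻¹ * x) = wordNorm (unionGen S) x →
      wordNorm (unionGen S) w + wordNorm (unionGen S) (w⁻¹ * y) = wordNorm (unionGen S) y →
      head i (w⁻¹ * x) ≠ head i (w⁻¹ * y) → ∃ w i, head i w⁻¹ = 1 ∧
      wordNorm (unionGen S) w + wordNorm (unionGen S) (w⁻¹ * x) = wordNorm (unionGen S) x ∧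
      wordNorm (unionGen S) w + wordNorm (unionGen S) (w⁻¹ * y) = wordNorm (unionGen S) y ∧
      head i (w⁻¹ * x) ≠ head i (w⁻¹ * y) by
    obtain ⟨w, i, h1, h2, h3⟩ := exists_branching hS x y h
    exact H _ w i rfl h1 h2 h3
  intro n
  induction n using Nat.strong_induction_on with | _ n ih => ?_
  intro w i hn hx hy hne
  by_cases hw : head i w⁻¹ = 1
  · exact ⟨w, i, hw, hx, hy, hne⟩
  set c := head i w⁻¹ with hc
  have e : ∀ z, (w * CoprodI.of c)⁻¹ * z = CoprodI.of c⁻¹ * (w⁻¹ * z) := by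
    intro z; rw [mul_inv_rev, map_inv, mul_assoc]
  have h1 := wordNorm_eq_head_add hS i w⁻¹
  rw [← hc, ← mul_inv_rev, wordNorm_inv, wordNorm_inv] at h1
  have hpos : wordNorm (S i) c ≠ 0 := fun h => hw (wordNorm_eq_zero (hS i).2 h)
  have h2 : wordNorm (unionGen S) (CoprodI.of c⁻¹) = wordNorm (S i) c := by
    have := wordNorm_of_mul hS c⁻¹ (head_one i)
    rwa [mul_one, wordNorm_one, add_zero, wordNorm_inv] at this
  have key : ∀ z, wordNorm (unionGen S) w + wordNorm (unionGen S) (w⁻¹ * z) =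
      wordNorm (unionGen S) z → wordNorm (unionGen S) (w * CoprodI.of c) +
      wordNorm (unionGen S) ((w * CoprodI.of c)⁻¹ * z) = wordNorm (unionGen S) z := by
    intro z hz
    have h3 := wordNorm_mul_le hU (w * CoprodI.of c) ((w * CoprodI.of c)⁻¹ * z)
    have h4 := wordNorm_mul_le hU (CoprodI.of c⁻¹) (w⁻¹ * z)
    rw [mul_inv_cancel_left] at h3
    rw [← e] at h4
    omega
  refine ih _ ?_ (w * CoprodI.of c) i rfl (key x hx) (key y hy) ?_
  · omega
  · rw [e, e, head_of_mul, head_of_mul]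
    exact fun h => hne (mul_left_cancel h)

/-- Projections do not increase distance, so two infinite ones are equivalent and a finite one
cannot pair with an infinite one. If two finite ones ended differently, the rays would leave the
coset at different points and diverge. -/
theorem sameEnd_projRay (hS : ∀ i, IsFiniteGeneratingSet (S i)) (i : ι) {w : CoprodI G}
    (hw : head i w⁻¹ = 1) {ρ σ : GeodesicRay (unionGen S)} (h : raySetoid (unionGen S) ρ σ) :
    SameEnd (projRay hS i w hw ρ.toGen) (projRay hS i w hw σ.toGen) := by
  obtain ⟨C, hC⟩ := h
  have hd := isGraphDist_wordDist (hS i).2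
  have hdist : ∀ n, wordDist (S i) ((projRay hS i w hw ρ.toGen).1 n)
      ((projRay hS i w hw σ.toGen).1 n) ≤ C := fun n =>
    (dist_projRay_le hS i hw _ _ n).trans (hC _)
  have mixed : ∀ (a b : GenRay (S i)) g, (∀ n, wordDist (S i) (a.1 n) (b.1 n) ≤ C) →
      a.IsInfinite → ¬ b.EndsAt g := by
    rintro a b g hab ha ⟨N, hN⟩
    have h1 := ha (N + C + wordNorm (S i) g + 1)
    have h2 := hab (N + C + wordNorm (S i) g + 1)
    rw [hN _ (by omega)] at h2
    have := hd.tri 1 g (a.1 (N + C + wordNorm (S i) g + 1))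
    have := hd.comm g (a.1 (N + C + wordNorm (S i) g + 1))
    simp only [wordNorm] at *
    omega
  rcases (projRay hS i w hw ρ.toGen).isInfinite_or_endsAt (hS i) with h1 | ⟨a, ha⟩ <;>
  rcases (projRay hS i w hw σ.toGen).isInfinite_or_endsAt (hS i) with h2 | ⟨b, hb⟩
  · obtain ⟨ρ', hρ'⟩ := h1.exists_toGen_eq (hS i)
    obtain ⟨σ', hσ'⟩ := h2.exists_toGen_eq (hS i)
    refine Or.inr ⟨(ρ', σ'), hρ', hσ', C, fun n => ?_⟩
    rw [← hρ', ← hσ'] at hdist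
    exact hdist n
  · exact absurd hb (mixed _ _ b hdist h1)
  · exact absurd ha (mixed _ _ a (fun n => by rw [wordDist_comm]; exact hdist n) h2)
  · have hab : a = b := by
      by_contra hne
      obtain ⟨N, hN⟩ := ha
      obtain ⟨M, hM⟩ := hb
      -- At this time both projections have stopped and `ρ` is more than `C` away from the point `a`
      -- of the coset, a distance that any geodesic to `σ` has to cover.
      set n := N + M + C + wordNorm (S i) a + 1 with hn
      have h1 : head i (w⁻¹ * ρ.1 (wordNorm (unionGen S) w + n)) = a := hN n (by omega)
      have h2 : head i (w⁻¹ * σ.1 (wordNorm (unionGen S) w + n)) = b := hM n (by omega)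
      have h3 := wordDist_of_head_ne hS (i := i)
        (x := w⁻¹ * ρ.1 (wordNorm (unionGen S) w + n))
        (y := w⁻¹ * σ.1 (wordNorm (unionGen S) w + n)) (by rwa [h1, h2])
      have h4 := wordNorm_eq_head_add hS i (w⁻¹ * ρ.1 (wordNorm (unionGen S) w + n))
      have h5 := wordNorm_mul_le (closure_unionGen hS) w
        (w⁻¹ * ρ.1 (wordNorm (unionGen S) w + n))
      have h6 := hC (wordNorm (unionGen S) w + n)
      rw [wordDist_mul_left] at h3
      rw [mul_inv_cancel_left, ρ.norm_eq] at h5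
      rw [h1] at h3 h4
      omega
    exact Or.inl ⟨a, ha, hab ▸ hb⟩

/-- At a time when the rays differ, consider a coset where they branch. Their projections differ, so
by `SameEnd.of_ne` they still move at full speed; hence both points lie in the coset, where the
distance is bounded by hyperbolicity of the factor. -/
theorem equiv_of_forall_sameEnd_projRay [Finite ι] (hS : ∀ i, IsFiniteGeneratingSet (S i))
    (hyp : ∀ i, IsHyperbolicWith (S i)) {ρ σ : GeodesicRay (unionGen S)}
    (h : ∀ i w hw, SameEnd (projRay hS i w hw ρ.toGen) (projRay hS i w hw σ.toGen)) :
    raySetoid (unionGen S) ρ σ := by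
  choose δ hδ using hyp
  obtain ⟨D, hD⟩ := (Set.finite_range δ).bddAbove
  refine ⟨2 * D, fun n => ?_⟩
  by_cases hne : ρ.1 n = σ.1 n
  · rw [hne, wordDist_self]; omega
  obtain ⟨w, i, hw, h1, h2, h3⟩ := exists_branching_of_ne hS hne
  rw [ρ.norm_eq] at h1
  rw [σ.norm_eq] at h2
  obtain ⟨k, rfl⟩ : ∃ k, n = wordNorm (unionGen S) w + k := ⟨n - wordNorm (unionGen S) w, by omega⟩
  obtain ⟨h4, h5, h6⟩ := (h i w hw).of_ne (hS i) (hδ i) (k := k) h3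
  change wordNorm (S i) (head i (w⁻¹ * ρ.1 (wordNorm (unionGen S) w + k))) = k at h4
  change wordNorm (S i) (head i (w⁻¹ * σ.1 (wordNorm (unionGen S) w + k))) = k at h5
  change wordDist (S i) (head i (w⁻¹ * ρ.1 (wordNorm (unionGen S) w + k)))
    (head i (w⁻¹ * σ.1 (wordNorm (unionGen S) w + k))) ≤ _ at h6
  have h7 := wordNorm_eq_head_add hS i (w⁻¹ * ρ.1 (wordNorm (unionGen S) w + k))
  have h8 := wordNorm_eq_head_add hS i (w⁻¹ * σ.1 (wordNorm (unionGen S) w + k))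
  have h9 := wordDist_of_head_ne hS h3
  have h10 : δ i ≤ D := hD ⟨i, rfl⟩
  rw [wordDist_mul_left] at h9
  omega

end Projection

/-! ### The homeomorphism between boundaries of free products. -/

section FreeProductBoundary

variable {ι : Type*} {G H : ι → Type*} [∀ i, Group (G i)] [∀ i, Group (H i)]
  {S : ∀ i, Set (G i)} {T : ∀ i, Set (H i)}

/-- The correspondence between generalized rays in two free products whose projections to the
factors correspond. -/
def freeProductCorrespondence (hS : ∀ i, IsFiniteGeneratingSet (S i))
    (hT : ∀ i, IsFiniteGeneratingSet (T i)) (α : ∀ i, G i ≃ H i) (hα : ∀ i, α i 1 = 1)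
    (f : ∀ i, GromovBoundary (S i) ≃ₜ GromovBoundary (T i)) :
    Set (GenRay (unionGen S) × GenRay (unionGen T)) :=
  {p | ∀ i w hw hw', (projRay hS i w hw p.1, projRay hT i (letterwise α hα w) hw' p.2) ∈
    rayCorrespondence (α i) (f i)}

theorem mem_freeProductCorrespondence_of_tendsto {hS : ∀ i, IsFiniteGeneratingSet (S i)}
    {hT : ∀ i, IsFiniteGeneratingSet (T i)} {α : ∀ i, G i ≃ H i} {hα : ∀ i, α i 1 = 1}
    {f : ∀ i, GromovBoundary (S i) ≃ₜ GromovBoundary (T i)}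
    (hcl : ∀ i, IsClosed (rayCorrespondence (α i) (f i))) {X : Type*} {F : Filter X} [F.NeBot]
    {γ : X → GenRay (unionGen S)} {η : X → GenRay (unionGen T)} {ρ : GenRay (unionGen S)}
    {σ : GenRay (unionGen T)} (hγ : Tendsto γ F (𝓝 ρ)) (hη : Tendsto η F (𝓝 σ))
    (h : ∀ᶠ t in F, (γ t, η t) ∈ freeProductCorrespondence hS hT α hα f) :
    (ρ, σ) ∈ freeProductCorrespondence hS hT α hα f := fun i w hw hw' =>
  (hcl i).mem_of_tendsto ((tendsto_projRay hS i hw hγ).prodMk_nhds (tendsto_projRay hT i hw' hη))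
    (h.mono fun _ ht => ht i w hw hw')

theorem mem_freeProductCorrespondence_of_endsAt {hS : ∀ i, IsFiniteGeneratingSet (S i)}
    {hT : ∀ i, IsFiniteGeneratingSet (T i)} {α : ∀ i, G i ≃ H i} {hα : ∀ i, α i 1 = 1}
    {f : ∀ i, GromovBoundary (S i) ≃ₜ GromovBoundary (T i)} {ρ : GenRay (unionGen S)}
    {σ : GenRay (unionGen T)} {x : CoprodI G} (hρ : ρ.EndsAt x)
    (hσ : σ.EndsAt (letterwise α hα x)) : (ρ, σ) ∈ freeProductCorrespondence hS hT α hα f := by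
  intro i w hw hw'
  refine Or.inl ⟨_, hρ.projRay hS i hw, ?_⟩
  rw [← head_inv_mul_letterwise α hα w i x hw]
  exact hσ.projRay hT i hw'

theorem homeomorph_gromovBoundary_unionGen [Finite ι] [∀ i, Infinite (G i)] [∀ i, Infinite (H i)]
    (hS : ∀ i, IsFiniteGeneratingSet (S i)) (hT : ∀ i, IsFiniteGeneratingSet (T i))
    (hS' : ∀ i, IsHyperbolicWith (S i)) (hT' : ∀ i, IsHyperbolicWith (T i))
    (f : ∀ i, GromovBoundary (S i) ≃ₜ GromovBoundary (T i)) :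
    Nonempty (GromovBoundary (unionGen S) ≃ₜ GromovBoundary (unionGen T)) := by
  choose α hα hcl using fun i =>
    exists_equiv_isClosed_rayCorrespondence (hS i) (hT i) (hS' i) (hT' i) (f i)
  have fS := isFiniteGeneratingSet_unionGen hS
  have fT := isFiniteGeneratingSet_unionGen hT
  have := compactSpace_geodesicRay fS
  have := compactSpace_geodesicRay fT
  set R := freeProductCorrespondence hS hT α hα f
  refine homeomorph_quotient_of_correspondence (raySetoid (unionGen S)) (raySetoid (unionGen T))
    {p | (p.1.toGen, p.2.toGen) ∈ R} ?_ ?_ ?_ ?_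
  · refine isClosed_iff_ultrafilter.2 ?_
    rintro ⟨ρ, σ⟩ u hu hmem
    exact mem_freeProductCorrespondence_of_tendsto hcl
      (GenRay.tendsto_toGen_iff.2 ((continuous_fst.tendsto (ρ, σ)).comp (tendsto_id'.2 hu)))
      (GenRay.tendsto_toGen_iff.2 ((continuous_snd.tendsto (ρ, σ)).comp (tendsto_id'.2 hu))) hmem
  · intro ρ
    -- A partner of `ρ` is a limit of geodesics to the images of its points. Initial segments of `ρ`
    -- correspond to these geodesics, and the relation is closed.
    choose η hη using fun n => GenRay.exists_endsAt fT (letterwise α hα (ρ.1 n))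
    obtain ⟨σ, hσ⟩ := exists_tendsto_genRay fT (hyperfilter ℕ) η
    obtain ⟨σ, rfl⟩ := (GenRay.isInfinite_of_tendsto_of_injective fT
      ((letterwise_injective α hα).comp ρ.injective) hη hσ).exists_toGen_eq fT
    exact ⟨σ, mem_freeProductCorrespondence_of_tendsto hcl
      (ρ.toGen.tendsto_truncate.mono_left Nat.hyperfilter_le_atTop) hσ
      (Eventually.of_forall fun n =>
        mem_freeProductCorrespondence_of_endsAt (ρ.toGen.truncate_endsAt n) (hη n))⟩
  · intro σ
    set β := letterwise (fun i => (α i).symm) fun i => symm_apply_one (hα i)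
    choose γ hγ using fun n => GenRay.exists_endsAt fS (β (σ.1 n))
    obtain ⟨ρ, hρ⟩ := exists_tendsto_genRay fS (hyperfilter ℕ) γ
    obtain ⟨ρ, rfl⟩ := (GenRay.isInfinite_of_tendsto_of_injective fS
      ((letterwise_injective _ _).comp σ.injective) hγ hρ).exists_toGen_eq fS
    refine ⟨ρ, mem_freeProductCorrespondence_of_tendsto hcl hρ
      (σ.toGen.tendsto_truncate.mono_left Nat.hyperfilter_le_atTop)
      (Eventually.of_forall fun n => mem_freeProductCorrespondence_of_endsAt (hγ n) ?_)⟩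
    rw [letterwise_letterwise_symm]
    exact σ.toGen.truncate_endsAt n
  · intro ρ σ ρ' σ' h h'
    have hhead : ∀ i w, head i w⁻¹ = 1 → head i (letterwise α hα w)⁻¹ = 1 := by
      intro i w hw
      have := head_inv_mul_letterwise α hα w i 1 hw
      rwa [letterwise_one, mul_one, mul_one, hw, hα] at this
    constructor
    · intro hρ
      refine equiv_of_forall_sameEnd_projRay hT hT' fun i v hv => ?_
      -- Every coset representative in the target comes from the source, so projections to all
      -- cosets are controlled.
      obtain ⟨w, rfl⟩ : ∃ w, letterwise α hα w = v := ⟨_, letterwise_letterwise_symm α hα v⟩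
      have hw : head i w⁻¹ = 1 := by
        have := head_inv_mul_letterwise (fun i => (α i).symm) (fun i => symm_apply_one (hα i))
          (letterwise α hα w) i 1 hv
        rwa [letterwise_symm_letterwise, letterwise_one, mul_one, mul_one, hv,
          symm_apply_one (hα i)] at this
      exact (sameEnd_iff_of_mem_rayCorrespondence (h i w hw hv) (h' i w hw hv)).1
        (sameEnd_projRay hS i hw hρ)
    · intro hσ
      refine equiv_of_forall_sameEnd_projRay hS hS' fun i w hw => ?_
      exact (sameEnd_iff_of_mem_rayCorrespondence (h i w hw (hhead i w hw))
        (h' i w hw (hhead i w hw))).2 (sameEnd_projRay hT i (hhead i w hw) hσ)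

end FreeProductBoundary

end HypGroup

namespace HypGroup

open Monoid

/-! ### From indexed to binary free products, with lifts to a common universe. -/

section BinaryFreeProduct

universe u v

variable (A : Type u) (B : Type v)

/-- Two types as a family indexed by `Bool`. -/
abbrev boolFamily (b : Bool) : Type (max u v) := Bool.rec (ULift.{v} A) (ULift.{u} B) b

instance [Group A] [Group B] (b : Bool) : Group (boolFamily A B b) :=
  match b with
  | false => inferInstanceAs (Group (ULift.{v} A))
  | true => inferInstanceAs (Group (ULift.{u} B))

theorem infinite_boolFamily [Infinite A] [Infinite B] (b : Bool) : Infinite (boolFamily A B b) :=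
  match b with
  | false => inferInstanceAs (Infinite (ULift.{v} A))
  | true => inferInstanceAs (Infinite (ULift.{u} B))

variable [Group A] [Group B]

/-- The first factor of the family is isomorphic to `A`. -/
def boolFamilyFalse : boolFamily A B false ≃* A := MulEquiv.ulift

/-- The second factor of the family is isomorphic to `B`. -/
def boolFamilyTrue : boolFamily A B true ≃* B := MulEquiv.ulift

/-- The binary free product as an indexed free product. -/
def coprodEquivCoprodI : A ∗ B ≃* CoprodI (boolFamily A B) :=
  MonoidHom.toMulEquiv
    (Coprod.lift ((CoprodI.of (i := false)).comp (boolFamilyFalse A B).symm.toMonoidHom)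
      ((CoprodI.of (i := true)).comp (boolFamilyTrue A B).symm.toMonoidHom))
    (CoprodI.lift fun b => match b with
      | false => (Coprod.inl (N := B)).comp (boolFamilyFalse A B).toMonoidHom
      | true => (Coprod.inr (M := A)).comp (boolFamilyTrue A B).toMonoidHom)
    (by ext x <;> simp)
    (by
      ext b x
      cases b <;> simp)

end BinaryFreeProduct

theorem IsFiniteGeneratingSet.image_mulEquiv {G H : Type*} [Group G] [Group H] {S : Set G}
    (hS : IsFiniteGeneratingSet S) (φ : G ≃* H) : IsFiniteGeneratingSet (φ '' S) := by
  refine ⟨hS.1.image _, ?_⟩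
  have := φ.toMonoidHom.map_closure S
  rw [hS.2] at this
  rw [show (φ '' S) = φ.toMonoidHom '' S from rfl, ← this]
  exact Subgroup.map_top_of_surjective _ φ.surjective

theorem IsHyperbolicGroup.isHyperbolicWith {G : Type*} [Group G] (h : IsHyperbolicGroup G)
    {S : Set G} (hS : IsFiniteGeneratingSet S) : IsHyperbolicWith S := by
  obtain ⟨T, hT, hT'⟩ := h
  exact hT'.of_mulEquiv hT hS (MulEquiv.refl G)

/-- Generating sets of two groups as a family of generating sets. -/
def boolGen {A B : Type*} [Group A] [Group B] (SA : Set A) (SB : Set B) (b : Bool) :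
    Set (boolFamily A B b) :=
  match b with
  | false => (boolFamilyFalse A B).symm '' SA
  | true => (boolFamilyTrue A B).symm '' SB

theorem isFiniteGeneratingSet_boolGen {A B : Type*} [Group A] [Group B] {SA : Set A} {SB : Set B}
    (hA : IsFiniteGeneratingSet SA) (hB : IsFiniteGeneratingSet SB) (b : Bool) :
    IsFiniteGeneratingSet (boolGen SA SB b) :=
  match b with
  | false => hA.image_mulEquiv _
  | true => hB.image_mulEquiv _

theorem isHyperbolicWith_boolGen {A B : Type*} [Group A] [Group B] {SA : Set A} {SB : Set B}
    (hA : IsFiniteGeneratingSet SA) (hB : IsFiniteGeneratingSet SB) (hA' : IsHyperbolicWith SA)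
    (hB' : IsHyperbolicWith SB) (b : Bool) : IsHyperbolicWith (boolGen SA SB b) :=
  match b with
  | false => hA'.of_mulEquiv hA (hA.image_mulEquiv _) (boolFamilyFalse A B).symm
  | true => hB'.of_mulEquiv hB (hB.image_mulEquiv _) (boolFamilyTrue A B).symm

theorem isHyperbolicGroup_coprod {A B : Type*} [Group A] [Group B] {SA : Set A} {SB : Set B}
    (hA : IsFiniteGeneratingSet SA) (hB : IsFiniteGeneratingSet SB) (hA' : IsHyperbolicWith SA)
    (hB' : IsHyperbolicWith SB) : IsHyperbolicGroup (A ∗ B) := by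
  have h1 := isFiniteGeneratingSet_unionGen (isFiniteGeneratingSet_boolGen hA hB)
  have h2 := isHyperbolicWith_unionGen (isFiniteGeneratingSet_boolGen hA hB)
    (isHyperbolicWith_boolGen hA hB hA' hB')
  have h3 := h1.image_mulEquiv (coprodEquivCoprodI A B).symm
  exact ⟨_, h3, h2.of_mulEquiv h1 h3 (coprodEquivCoprodI A B).symm⟩

theorem homeomorph_gromovBoundary_coprod {A₁ B₁ A₂ B₂ : Type*} [Group A₁] [Group B₁] [Group A₂]
    [Group B₂] [Infinite A₁] [Infinite B₁] [Infinite A₂] [Infinite B₂] {SA₁ : Set A₁}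
    {SB₁ : Set B₁} {SA₂ : Set A₂} {SB₂ : Set B₂}
    (hA₁ : IsFiniteGeneratingSet SA₁) (hB₁ : IsFiniteGeneratingSet SB₁)
    (hA₂ : IsFiniteGeneratingSet SA₂) (hB₂ : IsFiniteGeneratingSet SB₂)
    (hypA₁ : IsHyperbolicWith SA₁) (hypB₁ : IsHyperbolicWith SB₁)
    (hypA₂ : IsHyperbolicWith SA₂) (hypB₂ : IsHyperbolicWith SB₂)
    (f : GromovBoundary SA₁ ≃ₜ GromovBoundary SA₂) (g : GromovBoundary SB₁ ≃ₜ GromovBoundary SB₂)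
    {S₁ : Set (A₁ ∗ B₁)} {S₂ : Set (A₂ ∗ B₂)} (hS₁ : IsFiniteGeneratingSet S₁)
    (hS₂ : IsFiniteGeneratingSet S₂) : Nonempty (GromovBoundary S₁ ≃ₜ GromovBoundary S₂) := by
  have fin₁ := isFiniteGeneratingSet_boolGen hA₁ hB₁
  have fin₂ := isFiniteGeneratingSet_boolGen hA₂ hB₂
  have hyp₁ := isHyperbolicWith_boolGen hA₁ hB₁ hypA₁ hypB₁
  have hyp₂ := isHyperbolicWith_boolGen hA₂ hB₂ hypA₂ hypB₂
  have := infinite_boolFamily A₁ B₁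
  have := infinite_boolFamily A₂ B₂
  have hf : ∀ b, Nonempty (GromovBoundary (boolGen SA₁ SB₁ b) ≃ₜ
      GromovBoundary (boolGen SA₂ SB₂ b)) := by
    intro b
    cases b with
    | false =>
      obtain ⟨e₁⟩ := homeomorph_gromovBoundary_of_mulEquiv hA₁ (fin₁ false)
        (boolFamilyFalse A₁ B₁).symm hypA₁
      obtain ⟨e₂⟩ := homeomorph_gromovBoundary_of_mulEquiv hA₂ (fin₂ false)
        (boolFamilyFalse A₂ B₂).symm hypA₂
      exact ⟨(e₁.symm.trans f).trans e₂⟩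
    | true =>
      obtain ⟨e₁⟩ := homeomorph_gromovBoundary_of_mulEquiv hB₁ (fin₁ true)
        (boolFamilyTrue A₁ B₁).symm hypB₁
      obtain ⟨e₂⟩ := homeomorph_gromovBoundary_of_mulEquiv hB₂ (fin₂ true)
        (boolFamilyTrue A₂ B₂).symm hypB₂
      exact ⟨(e₁.symm.trans g).trans e₂⟩
  obtain ⟨e⟩ := homeomorph_gromovBoundary_unionGen fin₁ fin₂ hyp₁ hyp₂ fun b => (hf b).some
  obtain ⟨e₁⟩ := homeomorph_gromovBoundary_of_mulEquiv (isFiniteGeneratingSet_unionGen fin₁) hS₁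
    (coprodEquivCoprodI A₁ B₁).symm (isHyperbolicWith_unionGen fin₁ hyp₁)
  obtain ⟨e₂⟩ := homeomorph_gromovBoundary_of_mulEquiv (isFiniteGeneratingSet_unionGen fin₂) hS₂
    (coprodEquivCoprodI A₂ B₂).symm (isHyperbolicWith_unionGen fin₂ hyp₂)
  exact ⟨(e₁.symm.trans e).trans e₂⟩

end HypGroup

theorem theorem4p1 {A₁ B₁ A₂ B₂ : Type*} [Group A₁] [Group B₁] [Group A₂] [Group B₂]
    [Infinite A₁] [Infinite B₁] [Infinite A₂] [Infinite B₂]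
    (hA₁ : HypGroup.IsHyperbolicGroup A₁) (hB₁ : HypGroup.IsHyperbolicGroup B₁)
    (hA₂ : HypGroup.IsHyperbolicGroup A₂) (hB₂ : HypGroup.IsHyperbolicGroup B₂)
    (SA₁ : Set A₁) (SB₁ : Set B₁) (SA₂ : Set A₂) (SB₂ : Set B₂)
    (hSA₁ : HypGroup.IsFiniteGeneratingSet SA₁) (hSB₁ : HypGroup.IsFiniteGeneratingSet SB₁)
    (hSA₂ : HypGroup.IsFiniteGeneratingSet SA₂) (hSB₂ : HypGroup.IsFiniteGeneratingSet SB₂)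
    (hA : Nonempty (HypGroup.GromovBoundary SA₁ ≃ₜ HypGroup.GromovBoundary SA₂))
    (hB : Nonempty (HypGroup.GromovBoundary SB₁ ≃ₜ HypGroup.GromovBoundary SB₂)) :
    HypGroup.IsHyperbolicGroup (A₁ ∗ B₁) ∧ HypGroup.IsHyperbolicGroup (A₂ ∗ B₂) ∧
      ∀ (S₁ : Set (A₁ ∗ B₁)) (S₂ : Set (A₂ ∗ B₂)),
        HypGroup.IsFiniteGeneratingSet S₁ → HypGroup.IsFiniteGeneratingSet S₂ →
          Nonempty (HypGroup.GromovBoundary S₁ ≃ₜ HypGroup.GromovBoundary S₂) := by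
  obtain ⟨f⟩ := hA
  obtain ⟨g⟩ := hB
  have h₁ := hA₁.isHyperbolicWith hSA₁
  have h₂ := hB₁.isHyperbolicWith hSB₁
  have h₃ := hA₂.isHyperbolicWith hSA₂
  have h₄ := hB₂.isHyperbolicWith hSB₂
  exact ⟨HypGroup.isHyperbolicGroup_coprod hSA₁ hSB₁ h₁ h₂,
    HypGroup.isHyperbolicGroup_coprod hSA₂ hSB₂ h₃ h₄, fun S₁ S₂ hS₁ hS₂ =>
      HypGroup.homeomorph_gromovBoundary_coprod hSA₁ hSB₁ hSA₂ hSB₂ h₁ h₂ h₃ h₄ f g hS₁ hS₂⟩
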